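/- Let $J^1=\mathbb{R}^5$ have coordinates $(x,y,u,u_x,u_y)$, and let $U\subseteq J^1$ be a connected open set such that for all $(p,q)\in\mathbb{R}^2$ the fibre $\{z\in U: u_x=p,\ u_y=q\}$ is connected or empty (for example $U=J^1$, or any convex open set). Equip $C^\infty(U)$ with the Jacobi bracket $\{\varphi,\psi\}=L_\varphi(\psi)-L_\psi(\varphi)$, where $L_\varphi=\sum_\sigma D_\sigma(\varphi)\,\partial/\partial u_\sigma$ is the evolutionary vector field with generator $\varphi$ and $D_x,D_y$ are the total derivatives. A function $\varphi\in C^\infty(U)$ is a contact symmetry of the minimal surface equation $$F=(1+u_y^2)u_{xx}-2u_xu_yu_{xy}+(1+u_x^2)u_{yy}=0\qquad(1)$$ if $L_\varphi(F)=0$ at all jets over $U$ that satisfy $F=0$ and its differential consequences $D_xF=D_yF=0$; it is a point symmetry if moreover $\varphi=\eta-\xi u_x-\zeta u_y$ with $\xi,\zeta,\eta$ functions of $(x,y,u)$. **Proposition 1.** The contact symmetries of (1) on $U$ form a Lie subalgebra of $C^\infty(U)$. It is generated as a Lie algebra, and even spanned as a real vector space, by the functions $\phi(u_x,u_y)$,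 where $\phi(p,q)$ is a smooth solution on $\{(u_x,u_y)(z): z\in U\}$ of the linear equation $$(1+p^2)\phi_{pp}+2pq\,\phi_{pq}+(1+q^2)\phi_{qq}=0\qquad(2)$$ (the image of (1) under the Legendre transformation $\phi=xu_x+yu_y-u$, $p=u_x$, $q=u_y$), together with the following seven functions: the shift $1$, the translations $u_x$ and $u_y$, the rotations $yu_x-xu_y$, $x+u\,u_x$ and $y+u\,u_y$, and the dilatation $u-xu_x-yu_y$. The functions $1,u_x,u_y$ are themselves of the form $\phi(u_x,u_y)$ with $\phi$ a solution of (2), and the seven functions span the space of all point symmetries of (1) on $U$. -/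

import Mathlib

open scoped ContDiff

noncomputable section

namespace MinimalSurface

/-- Coordinates `(x, y, u, u_x, u_y)`, numbered `0, …, 4`. -/
abbrev Jet1 : Type := Fin 5 → ℝ

/-- Coordinates `(x, y, u, u_x, u_y, u_xx, u_xy, u_yy)`, numbered `0, …, 7`. -/
abbrev Jet2 : Type := Fin 8 → ℝ

/-- Coordinates `(x, y, u, u_x, u_y, u_xx, u_xy, u_yy, u_xxx, u_xxy, u_xyy, u_yyy)`,
numbered `0, …, 11`. -/
abbrev Jet3 : Type := Fin 12 → ℝ

def toJet1 (θ : Jet2) : Jet1 := fun i => θ (Fin.castLE (by decide) i)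

def toJet2 (θ : Jet3) : Jet2 := fun i => θ (Fin.castLE (by decide) i)

/-- The partial derivative of `f` with respect to the `i`-th coordinate. -/
def pd {n : ℕ} (i : Fin n) (f : (Fin n → ℝ) → ℝ) : (Fin n → ℝ) → ℝ :=
  fun z => fderiv ℝ f z (Pi.single i 1)

/-- The total derivative `D_x` of a function on the first jets. -/
def totalX₁ (f : Jet1 → ℝ) : Jet2 → ℝ := fun θ =>
  pd 0 f (toJet1 θ) + θ 3 * pd 2 f (toJet1 θ) + θ 5 * pd 3 f (toJet1 θ) + θ 6 * pd 4 f (toJet1 θ)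

/-- The total derivative `D_y` of a function on the first jets. -/
def totalY₁ (f : Jet1 → ℝ) : Jet2 → ℝ := fun θ =>
  pd 1 f (toJet1 θ) + θ 4 * pd 2 f (toJet1 θ) + θ 6 * pd 3 f (toJet1 θ) + θ 7 * pd 4 f (toJet1 θ)

/-- The total derivative `D_x` of a function on the second jets. -/
def totalX₂ (g : Jet2 → ℝ) : Jet3 → ℝ := fun θ =>
  pd 0 g (toJet2 θ) + θ 3 * pd 2 g (toJet2 θ) + θ 5 * pd 3 g (toJet2 θ) + θ 6 * pd 4 g (toJet2 θ)
    + θ 8 * pd 5 g (toJet2 θ) + θ 9 * pd 6 g (toJet2 θ) + θ 10 * pd 7 g (toJet2 θ)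

/-- The total derivative `D_y` of a function on the second jets. -/
def totalY₂ (g : Jet2 → ℝ) : Jet3 → ℝ := fun θ =>
  pd 1 g (toJet2 θ) + θ 4 * pd 2 g (toJet2 θ) + θ 6 * pd 3 g (toJet2 θ) + θ 7 * pd 4 g (toJet2 θ)
    + θ 9 * pd 5 g (toJet2 θ) + θ 10 * pd 6 g (toJet2 θ) + θ 11 * pd 7 g (toJet2 θ)

/-- The evolutionary vector field `L_φ = ∑_σ D_σ(φ) ∂/∂u_σ` with generator `φ`, applied to a
function on the first jets. -/
def evolutionary₁ (φ g : Jet1 → ℝ) : Jet2 → ℝ := fun θ =>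
  φ (toJet1 θ) * pd 2 g (toJet1 θ) + totalX₁ φ θ * pd 3 g (toJet1 θ)
    + totalY₁ φ θ * pd 4 g (toJet1 θ)

/-- The evolutionary vector field `L_φ = ∑_σ D_σ(φ) ∂/∂u_σ` with generator `φ`, applied to a
function on the second jets. -/
def evolutionary₂ (φ : Jet1 → ℝ) (g : Jet2 → ℝ) : Jet3 → ℝ := fun θ =>
  φ (toJet1 (toJet2 θ)) * pd 2 g (toJet2 θ)
    + totalX₁ φ (toJet2 θ) * pd 3 g (toJet2 θ) + totalY₁ φ (toJet2 θ) * pd 4 g (toJet2 θ)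
    + totalX₂ (totalX₁ φ) θ * pd 5 g (toJet2 θ) + totalX₂ (totalY₁ φ) θ * pd 6 g (toJet2 θ)
    + totalY₂ (totalY₁ φ) θ * pd 7 g (toJet2 θ)

/-- `(1 + u_y²) u_xx - 2 u_x u_y u_xy + (1 + u_x²) u_yy`. -/
def minimalOperator : Jet2 → ℝ := fun θ =>
  (1 + θ 4 ^ 2) * θ 5 - 2 * θ 3 * θ 4 * θ 6 + (1 + θ 3 ^ 2) * θ 7

/-- The third jets that satisfy the minimal surface equation together with its first-order
differential consequences. -/
def minimalEquation : Set Jet3 :=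
  {θ | minimalOperator (toJet2 θ) = 0 ∧ totalX₂ minimalOperator θ = 0 ∧
    totalY₂ minimalOperator θ = 0}

/-- The Jacobi bracket `{φ, ψ} = L_φ(ψ) - L_ψ(φ)`, in which all second-order derivatives of `u`
cancel (see `jacobiBracket_eq_evolutionary`). -/
def jacobiBracket (φ ψ : Jet1 → ℝ) : Jet1 → ℝ := fun z =>
  φ z * pd 2 ψ z - ψ z * pd 2 φ z
    + (pd 0 φ z + z 3 * pd 2 φ z) * pd 3 ψ z - (pd 0 ψ z + z 3 * pd 2 ψ z) * pd 3 φ z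
    + (pd 1 φ z + z 4 * pd 2 φ z) * pd 4 ψ z - (pd 1 ψ z + z 4 * pd 2 ψ z) * pd 4 φ z

theorem jacobiBracket_eq_evolutionary (φ ψ : Jet1 → ℝ) (θ : Jet2) :
    jacobiBracket φ ψ (toJet1 θ) = evolutionary₁ φ ψ θ - evolutionary₁ ψ φ θ := by
  have h3 : toJet1 θ 3 = θ 3 := rfl
  have h4 : toJet1 θ 4 = θ 4 := rfl
  simp only [jacobiBracket, evolutionary₁, totalX₁, totalY₁, h3, h4]
  ring

/-- The space `C^∞(U)` of smooth functions on an open set `U` of first jets; a function on `U` is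
represented by its extension by zero. -/
def smoothFunctions (U : TopologicalSpace.Opens Jet1) : Submodule ℝ (Jet1 → ℝ) where
  carrier := {f | ContDiffOn ℝ ∞ f U ∧ ∀ z, z ∉ U → f z = 0}
  add_mem' := fun {f g} hf hg => ⟨hf.1.add hg.1, fun z hz => by simp [hf.2 z hz, hg.2 z hz]⟩
  zero_mem' := ⟨contDiffOn_const, fun _ _ => rfl⟩
  smul_mem' := fun c f hf => ⟨contDiffOn_const.smul hf.1, fun z hz => by simp [hf.2 z hz]⟩

abbrev SmoothFun (U : TopologicalSpace.Opens Jet1) : Type := smoothFunctions U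

/-- The restriction to `U` of a function on the first jets that is smooth on `U`. -/
def restrict (U : TopologicalSpace.Opens Jet1) (f : Jet1 → ℝ) (hf : ContDiffOn ℝ ∞ f U) :
    SmoothFun U :=
  ⟨Set.indicator (U : Set Jet1) f,
    hf.congr fun _ hz => Set.indicator_of_mem hz f, fun _ hz => Set.indicator_of_notMem hz f⟩

section Calculus

variable {U : TopologicalSpace.Opens Jet1} {f g : Jet1 → ℝ} {z : Jet1}

theorem differentiableAt_of_smooth (hf : ContDiffOn ℝ ∞ f U) (hz : z ∈ U) :
    DifferentiableAt ℝ f z :=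
  (hf.contDiffAt (U.isOpen.mem_nhds hz)).differentiableAt (by simp)

theorem pd_smooth (i : Fin 5) (hf : ContDiffOn ℝ ∞ f U) : ContDiffOn ℝ ∞ (pd i f) U :=
  (hf.fderiv_of_isOpen U.isOpen (by simp)).clm_apply contDiffOn_const

theorem coord_smooth (i : Fin 5) : ContDiffOn ℝ ∞ (fun z : Jet1 => z i) U := by fun_prop

theorem jacobiBracket_smooth (hf : ContDiffOn ℝ ∞ f U) (hg : ContDiffOn ℝ ∞ g U) :
    ContDiffOn ℝ ∞ (jacobiBracket f g) U := by
  have hf' := fun i => pd_smooth (U := U) i hf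
  have hg' := fun i => pd_smooth (U := U) i hg
  have h3 := coord_smooth (U := U) 3
  have h4 := coord_smooth (U := U) 4
  exact ((((((hf.mul (hg' 2)).sub (hg.mul (hf' 2))).add
    (((hf' 0).add (h3.mul (hf' 2))).mul (hg' 3))).sub
    (((hg' 0).add (h3.mul (hg' 2))).mul (hf' 3))).add
    (((hf' 1).add (h4.mul (hf' 2))).mul (hg' 4))).sub
    (((hg' 1).add (h4.mul (hg' 2))).mul (hf' 4)))

theorem pd_congr (i : Fin 5) (h : Set.EqOn f g U) (hz : z ∈ U) : pd i f z = pd i g z := by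
  have : f =ᶠ[nhds z] g := Filter.eventuallyEq_of_mem (U.isOpen.mem_nhds hz) h
  simp only [pd, this.fderiv_eq]

theorem pd_add (i : Fin 5) (hf : DifferentiableAt ℝ f z) (hg : DifferentiableAt ℝ g z) :
    pd i (fun w => f w + g w) z = pd i f z + pd i g z := by
  simp [pd, fderiv_fun_add hf hg]

theorem pd_sub (i : Fin 5) (hf : DifferentiableAt ℝ f z) (hg : DifferentiableAt ℝ g z) :
    pd i (fun w => f w - g w) z = pd i f z - pd i g z := by
  simp [pd, fderiv_fun_sub hf hg]

theorem pd_mul (i : Fin 5) (hf : DifferentiableAt ℝ f z) (hg : DifferentiableAt ℝ g z) :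
    pd i (fun w => f w * g w) z = f z * pd i g z + g z * pd i f z := by
  simp [pd, fderiv_fun_mul hf hg]

theorem pd_coord (i j : Fin 5) : pd i (fun w : Jet1 => w j) z = if j = i then 1 else 0 := by
  have : HasFDerivAt (fun w : Jet1 => w j) (ContinuousLinearMap.proj (R := ℝ) j) z :=
    (ContinuousLinearMap.proj (R := ℝ) (φ := fun _ : Fin 5 => ℝ) j).hasFDerivAt
  simp [pd, this.fderiv, Pi.single_apply]

theorem pd_comm (i j : Fin 5) (hf : ContDiffOn ℝ ∞ f U) (hz : z ∈ U) :
    pd i (pd j f) z = pd j (pd i f) z := by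
  have hc : ContDiffAt ℝ ∞ f z := hf.contDiffAt (U.isOpen.mem_nhds hz)
  have hsym : IsSymmSndFDerivAt ℝ f z :=
    hc.isSymmSndFDerivAt (by simpa using (WithTop.coe_le_coe.2 le_top : ((2 : ℕ∞) : WithTop ℕ∞) ≤ ∞))
  have hd : DifferentiableAt ℝ (fderiv ℝ f) z :=
    (hc.fderiv_right (m := ∞) (by simp)).differentiableAt (by simp)
  have key : ∀ a b : Fin 5, pd a (pd b f) z =
      fderiv ℝ (fderiv ℝ f) z (Pi.single a 1) (Pi.single b 1) := by
    intro a b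
    have : HasFDerivAt (fun w => fderiv ℝ f w (Pi.single b 1))
        ((ContinuousLinearMap.apply ℝ ℝ (Pi.single b 1 : Jet1)).comp
          (fderiv ℝ (fderiv ℝ f) z)) z :=
      (ContinuousLinearMap.apply ℝ ℝ (Pi.single b 1 : Jet1)).hasFDerivAt.comp z hd.hasFDerivAt
    change fderiv ℝ (fun w => fderiv ℝ f w (Pi.single b 1)) z (Pi.single a 1) = _
    rw [this.fderiv]
    rfl
  rw [key, key]
  exact hsym _ _

theorem pd_jacobiBracket (i : Fin 5) (hf : ContDiffOn ℝ ∞ f U) (hg : ContDiffOn ℝ ∞ g U)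
    (hz : z ∈ U) : pd i (jacobiBracket f g) z =
      (f z * pd i (pd 2 g) z + pd 2 g z * pd i f z) - (g z * pd i (pd 2 f) z + pd 2 f z * pd i g z)
      + ((pd 0 f z + z 3 * pd 2 f z) * pd i (pd 3 g) z
        + pd 3 g z * (pd i (pd 0 f) z + (z 3 * pd i (pd 2 f) z
          + pd 2 f z * if (3 : Fin 5) = i then 1 else 0)))
      - ((pd 0 g z + z 3 * pd 2 g z) * pd i (pd 3 f) z
        + pd 3 f z * (pd i (pd 0 g) z + (z 3 * pd i (pd 2 g) z
          + pd 2 g z * if (3 : Fin 5) = i then 1 else 0)))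
      + ((pd 1 f z + z 4 * pd 2 f z) * pd i (pd 4 g) z
        + pd 4 g z * (pd i (pd 1 f) z + (z 4 * pd i (pd 2 f) z
          + pd 2 f z * if (4 : Fin 5) = i then 1 else 0)))
      - ((pd 1 g z + z 4 * pd 2 g z) * pd i (pd 4 f) z
        + pd 4 f z * (pd i (pd 1 g) z + (z 4 * pd i (pd 2 g) z
          + pd 2 g z * if (4 : Fin 5) = i then 1 else 0))) := by
  have df := differentiableAt_of_smooth hf hz
  have dg := differentiableAt_of_smooth hg hz
  have df' := fun j => differentiableAt_of_smooth (pd_smooth j hf) hz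
  have dg' := fun j => differentiableAt_of_smooth (pd_smooth j hg) hz
  have d3 := differentiableAt_of_smooth (coord_smooth (U := U) 3) hz
  have d4 := differentiableAt_of_smooth (coord_smooth (U := U) 4) hz
  have m1 := df.fun_mul (dg' 2)
  have m2 := dg.fun_mul (df' 2)
  have a1 := (df' 0).fun_add (d3.fun_mul (df' 2))
  have a2 := (dg' 0).fun_add (d3.fun_mul (dg' 2))
  have a3 := (df' 1).fun_add (d4.fun_mul (df' 2))
  have a4 := (dg' 1).fun_add (d4.fun_mul (dg' 2))
  have b1 := a1.fun_mul (dg' 3)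
  have b2 := a2.fun_mul (df' 3)
  have b3 := a3.fun_mul (dg' 4)
  have b4 := a4.fun_mul (df' 4)
  unfold jacobiBracket
  rw [pd_sub i (((m1.fun_sub m2).fun_add b1).fun_sub b2 |>.fun_add b3) b4,
    pd_add i (((m1.fun_sub m2).fun_add b1).fun_sub b2) b3,
    pd_sub i ((m1.fun_sub m2).fun_add b1) b2, pd_add i (m1.fun_sub m2) b1, pd_sub i m1 m2,
    pd_mul i df (dg' 2), pd_mul i dg (df' 2), pd_mul i a1 (dg' 3), pd_mul i a2 (df' 3),
    pd_mul i a3 (dg' 4), pd_mul i a4 (df' 4), pd_add i (df' 0) (d3.fun_mul (df' 2)),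
    pd_add i (dg' 0) (d3.fun_mul (dg' 2)), pd_add i (df' 1) (d4.fun_mul (df' 2)),
    pd_add i (dg' 1) (d4.fun_mul (dg' 2)), pd_mul i d3 (df' 2), pd_mul i d3 (dg' 2),
    pd_mul i d4 (df' 2), pd_mul i d4 (dg' 2), pd_coord, pd_coord]

end Calculus

instance (U : TopologicalSpace.Opens Jet1) : Bracket (SmoothFun U) (SmoothFun U) :=
  ⟨fun φ ψ => restrict U (jacobiBracket φ ψ) (jacobiBracket_smooth φ.2.1 ψ.2.1)⟩

theorem bracket_apply {U : TopologicalSpace.Opens Jet1} (φ ψ : SmoothFun U) {z : Jet1}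
    (hz : z ∈ U) : (⁅φ, ψ⁆ : SmoothFun U).1 z = jacobiBracket φ.1 ψ.1 z :=
  Set.indicator_of_mem hz _

theorem ext_on {U : TopologicalSpace.Opens Jet1} {φ ψ : SmoothFun U}
    (h : ∀ z ∈ U, φ.1 z = ψ.1 z) : φ = ψ := by
  apply Subtype.ext
  funext z
  by_cases hz : z ∈ U
  · exact h z hz
  · rw [φ.2.2 z hz, ψ.2.2 z hz]

theorem coe_add_apply {U : TopologicalSpace.Opens Jet1} (φ ψ : SmoothFun U) (z : Jet1) :
    (φ + ψ).1 z = φ.1 z + ψ.1 z := rfl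

theorem pd_coe_add {U : TopologicalSpace.Opens Jet1} (φ ψ : SmoothFun U) (i : Fin 5) {z : Jet1}
    (hz : z ∈ U) : pd i (φ + ψ).1 z = pd i φ.1 z + pd i ψ.1 z :=
  pd_add i (differentiableAt_of_smooth φ.2.1 hz) (differentiableAt_of_smooth ψ.2.1 hz)

theorem pd_coe_smul {U : TopologicalSpace.Opens Jet1} (c : ℝ) (φ : SmoothFun U) (i : Fin 5)
    {z : Jet1} (hz : z ∈ U) : pd i (c • φ).1 z = c * pd i φ.1 z := by
  have := fderiv_const_smul (differentiableAt_of_smooth φ.2.1 hz) c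
  change fderiv ℝ (c • φ.1) z _ = _
  rw [this]
  rfl

/-- The Lie algebra structure on `C^∞(U)` given by the Jacobi bracket. -/
instance (U : TopologicalSpace.Opens Jet1) : LieRing (SmoothFun U) where
  add_lie φ ψ χ := ext_on fun z hz => by
    simp only [coe_add_apply, bracket_apply _ _ hz, jacobiBracket, pd_coe_add _ _ _ hz]
    ring
  lie_add φ ψ χ := ext_on fun z hz => by
    simp only [coe_add_apply, bracket_apply _ _ hz, jacobiBracket, pd_coe_add _ _ _ hz]
    ring
  lie_self φ := ext_on fun z hz => by
    rw [bracket_apply _ _ hz]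
    simp only [jacobiBracket]
    change _ = (0 : ℝ)
    ring
  leibniz_lie φ ψ χ := ext_on fun z hz => by
    have hb : ∀ (α β : SmoothFun U) (i : Fin 5),
        pd i (⁅α, β⁆ : SmoothFun U).1 z = pd i (jacobiBracket α.1 β.1) z := fun α β i =>
      pd_congr i (fun w hw => bracket_apply α β hw) hz
    simp only [coe_add_apply, bracket_apply _ _ hz]
    unfold jacobiBracket
    simp only [hb, bracket_apply _ _ hz, pd_jacobiBracket _ φ.2.1 ψ.2.1 hz,
      pd_jacobiBracket _ ψ.2.1 χ.2.1 hz, pd_jacobiBracket _ φ.2.1 χ.2.1 hz]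
    unfold jacobiBracket
    have c : ∀ (α : SmoothFun U) (i j : Fin 5), pd i (pd j α.1) z = pd j (pd i α.1) z :=
      fun α i j => pd_comm i j α.2.1 hz
    simp only [c _ 1 0, c _ 2 0, c _ 3 0, c _ 4 0, c _ 2 1, c _ 3 1, c _ 4 1, c _ 3 2, c _ 4 2,
      c _ 4 3]
    simp only [Fin.reduceEq, if_true, if_false]
    ring

instance (U : TopologicalSpace.Opens Jet1) : LieAlgebra ℝ (SmoothFun U) where
  lie_smul c φ ψ := ext_on fun z hz => by
    have hs : ∀ χ : SmoothFun U, (c • χ).1 z = c * χ.1 z := fun _ => rfl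
    simp only [hs, bracket_apply _ _ hz, jacobiBracket, pd_coe_smul _ _ _ hz]
    ring

/-- The generators `φ ∈ C^∞(U)` of contact symmetries of the minimal surface equation: `L_φ(F) = 0`
on the equation `F = 0`. -/
def contactSymmetries (U : TopologicalSpace.Opens Jet1) : Set (SmoothFun U) :=
  {φ | ∀ θ ∈ minimalEquation, toJet1 (toJet2 θ) ∈ U → evolutionary₂ φ.1 minimalOperator θ = 0}

/-- The contact symmetries that are point symmetries: the generator is
`η - ξ u_x - ζ u_y` with `ξ, ζ, η` functions of `(x, y, u)`, that is, it comes from a vector field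
`ξ ∂_x + ζ ∂_y + η ∂_u`. -/
def pointSymmetries (U : TopologicalSpace.Opens Jet1) : Set (SmoothFun U) :=
  {φ ∈ contactSymmetries U | ∃ ξ ζ η : ℝ → ℝ → ℝ → ℝ, ∀ z ∈ U,
    φ.1 z = η (z 0) (z 1) (z 2) - ξ (z 0) (z 1) (z 2) * z 3 - ζ (z 0) (z 1) (z 2) * z 4}

/-- The set of values `(u_x, u_y)` on `U`. -/
def slopes (U : TopologicalSpace.Opens Jet1) : Set (Fin 2 → ℝ) :=
  (fun z : Jet1 => ![z 3, z 4]) '' U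

/-- The equation `(1 + p²) ϕ_pp + 2 p q ϕ_pq + (1 + q²) ϕ_qq = 0` on `W`, with `(p, q)` the
coordinates numbered `0, 1`. -/
def SolvesLegendre (ϕ : (Fin 2 → ℝ) → ℝ) (W : Set (Fin 2 → ℝ)) : Prop :=
  ∀ w ∈ W, (1 + w 0 ^ 2) * pd 0 (pd 0 ϕ) w + 2 * w 0 * w 1 * pd 1 (pd 0 ϕ) w
    + (1 + w 1 ^ 2) * pd 1 (pd 1 ϕ) w = 0

/-- The functions `ϕ(u_x, u_y)` on `U`, with `ϕ` a smooth solution of the linear equation. -/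
def legendreSolutions (U : TopologicalSpace.Opens Jet1) : Set (SmoothFun U) :=
  {φ | ∃ ϕ : (Fin 2 → ℝ) → ℝ, ContDiffOn ℝ ∞ ϕ (slopes U) ∧ SolvesLegendre ϕ (slopes U) ∧
    ∀ z ∈ U, φ.1 z = ϕ ![z 3, z 4]}

/-- The shift `1`. -/
def shift (U : TopologicalSpace.Opens Jet1) : SmoothFun U :=
  restrict U (fun _ => 1) (by fun_prop)

/-- The translation `u_x`. -/
def translationX (U : TopologicalSpace.Opens Jet1) : SmoothFun U :=
  restrict U (fun z => z 3) (by fun_prop)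

/-- The translation `u_y`. -/
def translationY (U : TopologicalSpace.Opens Jet1) : SmoothFun U :=
  restrict U (fun z => z 4) (by fun_prop)

/-- The rotation `y u_x - x u_y`. -/
def rotationXY (U : TopologicalSpace.Opens Jet1) : SmoothFun U :=
  restrict U (fun z => z 1 * z 3 - z 0 * z 4) (by fun_prop)

/-- The rotation `x + u u_x`. -/
def rotationX (U : TopologicalSpace.Opens Jet1) : SmoothFun U :=
  restrict U (fun z => z 0 + z 2 * z 3) (by fun_prop)

/-- The rotation `y + u u_y`. -/
def rotationY (U : TopologicalSpace.Opens Jet1) : SmoothFun U :=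
  restrict U (fun z => z 1 + z 2 * z 4) (by fun_prop)

/-- The dilatation `u - x u_x - y u_y`. -/
def dilatation (U : TopologicalSpace.Opens Jet1) : SmoothFun U :=
  restrict U (fun z => z 2 - z 0 * z 3 - z 1 * z 4) (by fun_prop)

def pointGenerators (U : TopologicalSpace.Opens Jet1) : Set (SmoothFun U) :=
  {shift U, translationX U, translationY U, rotationXY U, rotationX U, rotationY U, dilatation U}

end MinimalSurface

end

/-! Write p, q for u_x, u_y and r, s, t for the second derivatives; put X = ∂_x + p ∂_u, Y = ∂_y + q
∂_u, Z = ∂_u, P = ∂_p, Q = ∂_q and g = 1 + p² + q². Modulo F, D_xF and D_yF, the function L_φ(F) is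
a polynomial in r, s, t whose only quadratic term is a multiple of s² - rt
(`evolutionary₂_minimalOperator`). It must vanish on the plane F = 0 of (r, s, t)-space, which
amounts to five linear differential equations for φ (`forall_quadratic_eq_zero_iff`,
`mem_contactSymmetries_iff`); the coefficient of s² - rt gives the Legendre equation.

This overdetermined system is solved by cross-differentiation, using only the commutators [P, X] =
[Q, Y] = Z. The decisive operator is W = gZ - pX - qY, the derivative along the Euclidean normal
(-p, -q, 1). The equations force X(Wφ) = Y(Wφ) = 0 and P(Wφ/g) = Q(Wφ/g) = 0, so that Wφ/g is a
constant, the coefficient of the dilatation. Three more constants, the coefficients of the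
rotations, then determine Xφ, Yφ and Zφ (`IsSymmetry.exists_isNormal`). After subtraction of the
rotations and the dilatation, φ is killed by X, Y, Z; since the fibres are connected, it is a
function of the slopes, and it solves the Legendre equation (`mem_legendreSolutions_of_isNormal`).

Conversely, every φ of this normal form is a symmetry, and the normal forms are closed under the
bracket: the rotations form so(3) and act on the slopes by symmetries of the Legendre equation, the
dilatation scales its solutions, and the solutions commute. Hence the linear span is already a Lie
algebra. Finally, a function of the slopes that is also of the form η - ξ u_x - ζ u_y is affine in
the slopes, which gives the point symmetries. -/

open scoped ContDiff

namespace MinimalSurface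

/-! ### The determining equations and their differential consequences -/

/-- Derivations `X, Y, Z, P, Q` of a commutative algebra which satisfy the relations of
`∂_x + u_x ∂_u, ∂_y + u_y ∂_u, ∂_u, ∂_{u_x}, ∂_{u_y}`, with `p, q` in the role of `u_x, u_y`. -/
structure ContactFrame (R : Type*) [CommRing R] [Algebra ℝ R] where
  X : Derivation ℝ R R
  Y : Derivation ℝ R R
  Z : Derivation ℝ R R
  P : Derivation ℝ R R
  Q : Derivation ℝ R R
  p : R
  q : R
  X_p : X p = 0
  Y_p : Y p = 0
  Z_p : Z p = 0
  P_p : P p = 1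
  Q_p : Q p = 0
  X_q : X q = 0
  Y_q : Y q = 0
  Z_q : Z q = 0
  P_q : P q = 0
  Q_q : Q q = 1
  Y_X : ∀ f, Y (X f) = X (Y f)
  Z_X : ∀ f, Z (X f) = X (Z f)
  P_X : ∀ f, P (X f) = X (P f) + Z f
  Q_X : ∀ f, Q (X f) = X (Q f)
  Z_Y : ∀ f, Z (Y f) = Y (Z f)
  P_Y : ∀ f, P (Y f) = Y (P f)
  Q_Y : ∀ f, Q (Y f) = Y (Q f) + Z f
  P_Z : ∀ f, P (Z f) = Z (P f)
  Q_Z : ∀ f, Q (Z f) = Z (Q f)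
  Q_P : ∀ f, Q (P f) = P (Q f)
  regular : ∀ f, (1 + p * p + q * q) * f = 0 → f = 0

namespace ContactFrame

variable {R : Type*} [CommRing R] [Algebra ℝ R] (F : ContactFrame R)

attribute [simp] X_p Y_p Z_p P_p Q_p X_q Y_q Z_q P_q Q_q Y_X Z_X P_X Q_X Z_Y P_Y Q_Y P_Z Q_Z Q_P

theorem derivation_two (D : Derivation ℝ R R) : D 2 = 0 := by
  simpa using D.map_natCast 2

theorem eq_zero_of_two_mul {f : R} (h : 2 * f = 0) : f = 0 := by
  have hsmul : (2 : ℝ) • f = 0 := by rw [ofNat_smul_eq_nsmul, nsmul_eq_mul]; simpa using h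
  simpa using congrArg ((2 : ℝ)⁻¹ • ·) hsmul

/-- The trace of the linear part of the determining equations. -/
def trace (φ : R) : R :=
  (1 + F.p * F.p + F.q * F.q) * (F.X (F.P φ) + F.Y (F.Q φ)) + F.p * F.X φ + F.q * F.Y φ

/-- The coefficient of `s ^ 2 - r * t` in the determining equations. -/
def legendre (φ : R) : R :=
  (1 + F.p * F.p) * F.P (F.P φ) + 2 * F.p * F.q * F.P (F.Q φ) + (1 + F.q * F.q) * F.Q (F.Q φ)

/-- The determining equations of the contact symmetries of the minimal surface equation. -/
structure IsSymmetry (φ : R) : Prop where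
  const : (1 + F.q * F.q) * F.X (F.X φ) - 2 * F.p * F.q * F.X (F.Y φ)
    + (1 + F.p * F.p) * F.Y (F.Y φ) = 0
  quad : F.legendre φ = 0
  linR : 2 * (1 + F.p * F.p + F.q * F.q) * (F.q * F.Y φ + (1 + F.q * F.q) * F.X (F.P φ)
    - F.p * F.q * F.Y (F.P φ)) = (1 + F.q * F.q) * F.trace φ
  linS : (1 + F.p * F.p + F.q * F.q) * (- (F.q * F.X φ) - F.p * F.Y φ
    + (1 + F.q * F.q) * F.X (F.Q φ) - F.p * F.q * (F.Y (F.Q φ) + F.X (F.P φ))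
    + (1 + F.p * F.p) * F.Y (F.P φ)) = - (F.p * F.q * F.trace φ)
  linT : 2 * (1 + F.p * F.p + F.q * F.q) * (F.p * F.X φ - F.p * F.q * F.X (F.Q φ)
    + (1 + F.p * F.p) * F.Y (F.Q φ)) = (1 + F.p * F.p) * F.trace φ

theorem isSymmetry_iff {φ : R} : F.IsSymmetry φ ↔
    ((1 + F.q * F.q) * F.X (F.X φ) - 2 * F.p * F.q * F.X (F.Y φ)
    + (1 + F.p * F.p) * F.Y (F.Y φ) = 0) ∧
    (F.legendre φ = 0) ∧
    (2 * (1 + F.p * F.p + F.q * F.q) * (F.q * F.Y φ + (1 + F.q * F.q) * F.X (F.P φ)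
    - F.p * F.q * F.Y (F.P φ)) = (1 + F.q * F.q) * F.trace φ) ∧
    ((1 + F.p * F.p + F.q * F.q) * (- (F.q * F.X φ) - F.p * F.Y φ
    + (1 + F.q * F.q) * F.X (F.Q φ) - F.p * F.q * (F.Y (F.Q φ) + F.X (F.P φ))
    + (1 + F.p * F.p) * F.Y (F.P φ)) = - (F.p * F.q * F.trace φ)) ∧
    (2 * (1 + F.p * F.p + F.q * F.q) * (F.p * F.X φ - F.p * F.q * F.X (F.Q φ)
    + (1 + F.p * F.p) * F.Y (F.Q φ)) = (1 + F.p * F.p) * F.trace φ) :=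
  ⟨fun h => ⟨h.const, h.quad, h.linR, h.linS, h.linT⟩, fun h =>
      ⟨h.1, h.2.1, h.2.2.1, h.2.2.2.1, h.2.2.2.2⟩⟩

namespace IsSymmetry

set_option linter.unusedSimpArgs false

variable {F} {φ : R}

/-- As X kills p and q, this is X(Wφ) = 0 for the normal derivative W = gZ - pX - qY. The
third-order terms in P and Q of `const` cancel against the X- and Y-derivatives of the linear
equations. -/
theorem normal_X (h : F.IsSymmetry φ) :
    (1 + F.p * F.p + F.q * F.q) * F.X (F.Z φ) - F.p * F.X (F.X φ) - F.q * F.X (F.Y φ) = 0 := by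
  apply F.regular
  apply eq_zero_of_two_mul
  have hC := h.const
  have hPC := congrArg F.P h.const
  have hQC := congrArg F.Q h.const
  have hXL1 := congrArg F.X h.linR
  have hXL2 := congrArg F.X h.linS
  have hYL2 := congrArg F.Y h.linS
  have hYL3 := congrArg F.Y h.linT
  -- The commutation rules bring every iterated derivative into the order X, Y, Z, P, Q, with X
  -- outermost. The relations are then linear over `R` in the ordered derivatives of φ, and the
  -- multipliers below come from elimination; the other lemmas of this kind work in the same way.
  simp only [trace, legendre, map_add, map_sub, map_neg, map_zero, Derivation.leibniz, smul_eq_mul,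
    Derivation.map_one_eq_zero, derivation_two, X_p, Y_p, Z_p, P_p, Q_p, X_q, Y_q, Z_q, P_q, Q_q,
    Y_X, Z_X, P_X, Q_X, Z_Y, P_Y, Q_Y, P_Z, Q_Z, Q_P] at hC hPC hQC hXL1 hXL2 hYL2 hYL3
  linear_combination -3 * F.p * (1 + F.p * F.p + F.q * F.q) * hC
    + (1 + F.p * F.p) * (1 + F.p * F.p + F.q * F.q) * hPC
    + F.p * F.q * (1 + F.p * F.p + F.q * F.q) * hQC - (1 + F.p * F.p) * hXL1 - F.p * F.q * hXL2
    - (1 + F.p * F.p) * hYL2 - F.p * F.q * hYL3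

theorem normal_Y (h : F.IsSymmetry φ) :
    (1 + F.p * F.p + F.q * F.q) * F.Y (F.Z φ) - F.p * F.X (F.Y φ) - F.q * F.Y (F.Y φ) = 0 := by
  apply F.regular
  apply eq_zero_of_two_mul
  have hC := h.const
  have hPC := congrArg F.P h.const
  have hQC := congrArg F.Q h.const
  have hXL1 := congrArg F.X h.linR
  have hXL2 := congrArg F.X h.linS
  have hYL1 := congrArg F.Y h.linR
  have hYL2 := congrArg F.Y h.linS
  simp only [trace, legendre, map_add, map_sub, map_neg, map_zero, Derivation.leibniz, smul_eq_mul,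
    Derivation.map_one_eq_zero, derivation_two, X_p, Y_p, Z_p, P_p, Q_p, X_q, Y_q, Z_q, P_q, Q_q,
    Y_X, Z_X, P_X, Q_X, Z_Y, P_Y, Q_Y, P_Z, Q_Z, Q_P] at hC hPC hQC hXL1 hXL2 hYL1 hYL2
  linear_combination -3 * F.q * (1 + F.p * F.p + F.q * F.q) * hC
    + F.p * F.q * (1 + F.p * F.p + F.q * F.q) * hPC
    + (1 + F.q * F.q) * (1 + F.p * F.p + F.q * F.q) * hQC - F.p * F.q * hXL1
    - (1 + F.q * F.q) * hXL2 + (1 + F.p * F.p) * hYL1 + F.p * F.q * hYL2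

/-- W commutes with X and Y, so it kills Xφ and Yφ, and moving it past P or Q costs only first-order
terms. Hence W applied to `linT` reduces to XX, XY, YY, XZ, YZ of φ, and `const`, `normal_X`,
`normal_Y` reduce this to XXφ. The derivatives of the linear equations below add up to -W of `linT`,
because (1 + p²) `linR` + 2pq `linS` + (1 + q²) `linT` is trivial. `X_Y` and `Y_Y` arise likewise
from `linS` and `linR`. -/
theorem X_X (h : F.IsSymmetry φ) :
    F.X (F.X φ) = 0 := by
  apply F.regular
  apply eq_zero_of_two_mul
  have hC := h.const
  have hPWX := congrArg F.P h.normal_X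
  have hQWX := congrArg F.Q h.normal_X
  have hQWY := congrArg F.Q h.normal_Y
  have hWX := h.normal_X
  have hWY := h.normal_Y
  have hXL3 := congrArg F.X h.linT
  have hYL3 := congrArg F.Y h.linT
  have hZL1 := congrArg F.Z h.linR
  have hZL2 := congrArg F.Z h.linS
  have hZL3 := congrArg F.Z h.linT
  simp only [trace, legendre, map_add, map_sub, map_neg, map_zero, Derivation.leibniz, smul_eq_mul,
    Derivation.map_one_eq_zero, derivation_two, X_p, Y_p, Z_p, P_p, Q_p, X_q, Y_q, Z_q, P_q, Q_q,
    Y_X, Z_X, P_X, Q_X, Z_Y, P_Y, Q_Y, P_Z, Q_Z, Q_P]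
    at hC hPWX hQWX hQWY hWX hWY hXL3 hYL3 hZL1 hZL2 hZL3
  linear_combination (1 + F.p * F.p) * hC - (1 + F.p * F.p) * (1 + F.p * F.p + F.q * F.q) * hPWX
    - 2 * F.p * F.q * (1 + F.p * F.p + F.q * F.q) * hQWX
    + (1 + F.p * F.p) * (1 + F.p * F.p + F.q * F.q) * hQWY
    + (2 * F.p * (1 + F.p * F.p + F.q * F.q) + 2 * F.p * F.q * F.q) * hWX
    - 2 * F.q * (1 + F.p * F.p) * hWY + F.p * hXL3
    + F.q * hYL3 + (1 + F.p * F.p) * hZL1 + 2 * F.p * F.q * hZL2 - F.p * F.p * hZL3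

theorem X_Y (h : F.IsSymmetry φ) :
    F.X (F.Y φ) = 0 := by
  apply F.regular
  apply eq_zero_of_two_mul
  have hC := h.const
  have hPWY := congrArg F.P h.normal_Y
  have hQWX := congrArg F.Q h.normal_X
  have hWX := h.normal_X
  have hWY := h.normal_Y
  have hXL2 := congrArg F.X h.linS
  have hYL2 := congrArg F.Y h.linS
  have hZL2 := congrArg F.Z h.linS
  simp only [trace, legendre, map_add, map_sub, map_neg, map_zero, Derivation.leibniz, smul_eq_mul,
    Derivation.map_one_eq_zero, derivation_two, X_p, Y_p, Z_p, P_p, Q_p, X_q, Y_q, Z_q, P_q, Q_q,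
    Y_X, Z_X, P_X, Q_X, Z_Y, P_Y, Q_Y, P_Z, Q_Z, Q_P] at hC hPWY hQWX hWX hWY hXL2 hYL2 hZL2
  linear_combination F.p * F.q * hC - (1 + F.p * F.p) * (1 + F.p * F.p + F.q * F.q) * hPWY
    - (1 + F.q * F.q) * (1 + F.p * F.p + F.q * F.q) * hQWX
    + 2 * F.q * (1 + F.q * F.q) * hWX + 2 * F.p * (1 + F.p * F.p) * hWY - F.p * hXL2 - F.q * hYL2
    + (1 + F.p * F.p + F.q * F.q) * hZL2

theorem Y_Y (h : F.IsSymmetry φ) :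
    F.Y (F.Y φ) = 0 := by
  apply F.regular
  apply eq_zero_of_two_mul
  have hC := h.const
  have hPWX := congrArg F.P h.normal_X
  have hPWY := congrArg F.P h.normal_Y
  have hQWY := congrArg F.Q h.normal_Y
  have hWX := h.normal_X
  have hWY := h.normal_Y
  have hXL1 := congrArg F.X h.linR
  have hYL1 := congrArg F.Y h.linR
  have hZL1 := congrArg F.Z h.linR
  simp only [trace, legendre, map_add, map_sub, map_neg, map_zero, Derivation.leibniz, smul_eq_mul,
    Derivation.map_one_eq_zero, derivation_two, X_p, Y_p, Z_p, P_p, Q_p, X_q, Y_q, Z_q, P_q, Q_q,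
    Y_X, Z_X, P_X, Q_X, Z_Y, P_Y, Q_Y, P_Z, Q_Z, Q_P] at hC hPWX hPWY hQWY hWX hWY hXL1 hYL1 hZL1
  linear_combination (1 + F.q * F.q) * hC + (1 + F.q * F.q) * (1 + F.p * F.p + F.q * F.q) * hPWX
    - 2 * F.p * F.q * (1 + F.p * F.p + F.q * F.q) * hPWY
    - (1 + F.q * F.q) * (1 + F.p * F.p + F.q * F.q) * hQWY - 2 * F.p * (1 + F.q * F.q) * hWX
    + (2 * F.q * (1 + F.p * F.p + F.q * F.q) + 2 * F.p * F.p * F.q) * hWY + F.p * hXL1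
    + F.q * hYL1 - (1 + F.p * F.p + F.q * F.q) * hZL1

theorem X_Z (h : F.IsSymmetry φ) : F.X (F.Z φ) = 0 := by
  apply F.regular
  linear_combination h.normal_X + F.p * h.X_X + F.q * h.X_Y

theorem Y_Z (h : F.IsSymmetry φ) : F.Y (F.Z φ) = 0 := by
  apply F.regular
  linear_combination h.normal_Y + F.p * h.X_Y + F.q * h.Y_Y

/-- In terms of W this is g P(Wφ) - 2p Wφ = 0, that is, P(Wφ/g) = 0; `normal_Q` is Q(Wφ/g) = 0. The
X- and Y-derivatives of `quad` remove the third-order terms. -/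
theorem normal_P (h : F.IsSymmetry φ) :
    (1 + F.p * F.p + F.q * F.q) * (F.p * F.Z φ + (1 + F.p * F.p + F.q * F.q) * F.Z (F.P φ) - F.X φ
    - F.p * F.X (F.P φ) - F.q * F.Y (F.P φ))
    - 2 * F.p * ((1 + F.p * F.p + F.q * F.q) * F.Z φ - F.p * F.X φ - F.q * F.Y φ) = 0 := by
  apply eq_zero_of_two_mul
  apply eq_zero_of_two_mul
  have hPL1 := congrArg F.P h.linR
  have hPL2 := congrArg F.P h.linS
  have hPL3 := congrArg F.P h.linT
  have hQL1 := congrArg F.Q h.linR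
  have hQL2 := congrArg F.Q h.linS
  have hXE := congrArg F.X h.quad
  have hYE := congrArg F.Y h.quad
  simp only [trace, legendre, map_add, map_sub, map_neg, map_zero, Derivation.leibniz, smul_eq_mul,
    Derivation.map_one_eq_zero, derivation_two, X_p, Y_p, Z_p, P_p, Q_p, X_q, Y_q, Z_q, P_q, Q_q,
    Y_X, Z_X, P_X, Q_X, Z_Y, P_Y, Q_Y, P_Z, Q_Z, Q_P] at hPL1 hPL2 hPL3 hQL1 hQL2 hXE hYE
  linear_combination 5 * (1 + F.p * F.p) * hPL1 + 8 * F.p * F.q * hPL2 + 3 * (1 + F.q * F.q) * hPL3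
    + 2 * F.p * F.q * hQL1 + 2 * (1 + F.q * F.q) * hQL2
    - 2 * (1 + F.q * F.q) * (1 + F.p * F.p + F.q * F.q) * hXE
    + 2 * F.p * F.q * (1 + F.p * F.p + F.q * F.q) * hYE

theorem normal_Q (h : F.IsSymmetry φ) :
    (1 + F.p * F.p + F.q * F.q) * (F.q * F.Z φ + (1 + F.p * F.p + F.q * F.q) * F.Z (F.Q φ) - F.Y φ
    - F.p * F.X (F.Q φ) - F.q * F.Y (F.Q φ))
    - 2 * F.q * ((1 + F.p * F.p + F.q * F.q) * F.Z φ - F.p * F.X φ - F.q * F.Y φ) = 0 := by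
  apply eq_zero_of_two_mul
  apply eq_zero_of_two_mul
  have hPL2 := congrArg F.P h.linS
  have hPL3 := congrArg F.P h.linT
  have hQL1 := congrArg F.Q h.linR
  have hQL2 := congrArg F.Q h.linS
  have hQL3 := congrArg F.Q h.linT
  have hXE := congrArg F.X h.quad
  have hYE := congrArg F.Y h.quad
  simp only [trace, legendre, map_add, map_sub, map_neg, map_zero, Derivation.leibniz, smul_eq_mul,
    Derivation.map_one_eq_zero, derivation_two, X_p, Y_p, Z_p, P_p, Q_p, X_q, Y_q, Z_q, P_q, Q_q,
    Y_X, Z_X, P_X, Q_X, Z_Y, P_Y, Q_Y, P_Z, Q_Z, Q_P] at hPL2 hPL3 hQL1 hQL2 hQL3 hXE hYE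
  linear_combination 2 * (1 + F.p * F.p) * hPL2 + 2 * F.p * F.q * hPL3 + 3 * (1 + F.p * F.p) * hQL1
    + 8 * F.p * F.q * hQL2 + 5 * (1 + F.q * F.q) * hQL3
    + 2 * F.p * F.q * (1 + F.p * F.p + F.q * F.q) * hXE
    - 2 * (1 + F.p * F.p) * (1 + F.p * F.p + F.q * F.q) * hYE

/-- Two evaluations of the Legendre operator on Wφ are compared: one commutes it with W and uses
`quad`, the other uses that P and Q see Wφ as a constant multiple of g. -/
theorem trace_eq (h : F.IsSymmetry φ) :
    (1 + F.p * F.p + F.q * F.q) * (F.X (F.P φ) + F.Y (F.Q φ))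
    + 2 * (1 + F.p * F.p + F.q * F.q) * F.Z φ - 3 * F.p * F.X φ - 3 * F.q * F.Y φ = 0 := by
  apply eq_zero_of_two_mul
  have hN1 := h.normal_P
  have hN2 := h.normal_Q
  have hPN1 := congrArg F.P h.normal_P
  have hPN2 := congrArg F.P h.normal_Q
  have hQN1 := congrArg F.Q h.normal_P
  have hQN2 := congrArg F.Q h.normal_Q
  have hXE := congrArg F.X h.quad
  have hYE := congrArg F.Y h.quad
  have hZE := congrArg F.Z h.quad
  simp only [trace, legendre, map_add, map_sub, map_neg, map_zero, Derivation.leibniz, smul_eq_mul,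
    Derivation.map_one_eq_zero, derivation_two, X_p, Y_p, Z_p, P_p, Q_p, X_q, Y_q, Z_q, P_q, Q_q,
    Y_X, Z_X, P_X, Q_X, Z_Y, P_Y, Q_Y, P_Z, Q_Z, Q_P] at hN1 hN2 hPN1 hPN2 hQN1 hQN2 hXE hYE hZE
  linear_combination 2 * F.p * hN1 + 2 * F.q * hN2 - (1 + F.p * F.p) * hPN1 - F.p * F.q * hPN2
    - F.p * F.q * hQN1 - (1 + F.q * F.q) * hQN2 - F.p * (1 + F.p * F.p + F.q * F.q) * hXE
    - F.q * (1 + F.p * F.p + F.q * F.q) * hYE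
    + (1 + F.p * F.p + F.q * F.q) * (1 + F.p * F.p + F.q * F.q) * hZE

/-- Wφ/g is killed by X and P, hence by Z = [P, X]; since XZφ = YZφ = 0, Z(Wφ) is just g ZZφ. -/
theorem Z_Z (h : F.IsSymmetry φ) :
    F.Z (F.Z φ) = 0 := by
  apply F.regular
  apply F.regular
  have hXN1 := congrArg F.X h.normal_P
  have hPXX := congrArg F.P h.X_X
  have hPXY := congrArg F.P h.X_Y
  have hPXZ := congrArg F.P h.X_Z
  have hXX := h.X_X
  have hXY := h.X_Y
  have hXZ := h.X_Z
  have hYZ := h.Y_Z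
  simp only [trace, legendre, map_add, map_sub, map_neg, map_zero, Derivation.leibniz, smul_eq_mul,
    Derivation.map_one_eq_zero, derivation_two, X_p, Y_p, Z_p, P_p, Q_p, X_q, Y_q, Z_q, P_q, Q_q,
    Y_X, Z_X, P_X, Q_X, Z_Y, P_Y, Q_Y, P_Z, Q_Z, Q_P] at hXN1 hPXX hPXY hPXZ hXX hXY hXZ hYZ
  linear_combination -hXN1 - F.p * (1 + F.p * F.p + F.q * F.q) * hPXX
    - F.q * (1 + F.p * F.p + F.q * F.q) * hPXY
    + (1 + F.p * F.p + F.q * F.q) * (1 + F.p * F.p + F.q * F.q) * hPXZ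
    + (2 * F.p * F.p - (1 + F.p * F.p + F.q * F.q)) * hXX + 2 * F.p * F.q * hXY
    + F.p * (1 + F.p * F.p + F.q * F.q) * hXZ
    + F.q * (1 + F.p * F.p + F.q * F.q) * hYZ

/-- From here to `Y_eq` there is only linear elimination, without differentiation. The linear
equations have rank two; with `normal_P`, `normal_Q` and `trace_eq` they give five relations between
the nine quantities Xφ, Yφ, Zφ, XPφ, XQφ, YPφ, YQφ, ZPφ, ZQφ. Four remain free, as many as there are
rotations and dilatations. -/
theorem X_P (h : F.IsSymmetry φ) :
    F.X (F.P φ) + F.Z φ - 2 * F.p * F.Z (F.P φ) - F.q * F.Z (F.Q φ) = 0 := by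
  apply F.regular
  apply F.regular
  apply eq_zero_of_two_mul
  have hL1 := h.linR
  have hL3 := h.linT
  have hN1 := h.normal_P
  have hN2 := h.normal_Q
  have hS := h.trace_eq
  simp only [trace, legendre, map_add, map_sub, map_neg, map_zero, Derivation.leibniz, smul_eq_mul,
    Derivation.map_one_eq_zero, derivation_two, X_p, Y_p, Z_p, P_p, Q_p, X_q, Y_q, Z_q, P_q, Q_q,
    Y_X, Z_X, P_X, Q_X, Z_Y, P_Y, Q_Y, P_Z, Q_Z, Q_P] at hL1 hL3 hN1 hN2 hS
  linear_combination 2 * hL1 + hL3 - 4 * F.p * hN1 - 2 * F.q * hN2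
    + (1 - F.p * F.p) * hS

theorem Y_Q (h : F.IsSymmetry φ) :
    F.Y (F.Q φ) + F.Z φ - F.p * F.Z (F.P φ) - 2 * F.q * F.Z (F.Q φ) = 0 := by
  apply F.regular
  apply F.regular
  apply eq_zero_of_two_mul
  have hL1 := h.linR
  have hL3 := h.linT
  have hN1 := h.normal_P
  have hN2 := h.normal_Q
  have hS := h.trace_eq
  simp only [trace, legendre, map_add, map_sub, map_neg, map_zero, Derivation.leibniz, smul_eq_mul,
    Derivation.map_one_eq_zero, derivation_two, X_p, Y_p, Z_p, P_p, Q_p, X_q, Y_q, Z_q, P_q, Q_q,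
    Y_X, Z_X, P_X, Q_X, Z_Y, P_Y, Q_Y, P_Z, Q_Z, Q_P] at hL1 hL3 hN1 hN2 hS
  linear_combination hL1 + 2 * hL3 - 2 * F.p * hN1 - 4 * F.q * hN2
    + (1 - F.q * F.q) * hS

theorem X_Q_add_Y_P (h : F.IsSymmetry φ) :
    F.X (F.Q φ) + F.Y (F.P φ) - F.p * F.Z (F.Q φ) - F.q * F.Z (F.P φ) = 0 := by
  apply F.regular
  apply F.regular
  have hL2 := h.linS
  have hN1 := h.normal_P
  have hN2 := h.normal_Q
  have hS := h.trace_eq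
  simp only [trace, legendre, map_add, map_sub, map_neg, map_zero, Derivation.leibniz, smul_eq_mul,
    Derivation.map_one_eq_zero, derivation_two, X_p, Y_p, Z_p, P_p, Q_p, X_q, Y_q, Z_q, P_q, Q_q,
    Y_X, Z_X, P_X, Q_X, Z_Y, P_Y, Q_Y, P_Z, Q_Z, Q_P] at hL2 hN1 hN2 hS
  linear_combination hL2 - F.q * hN1 - F.p * hN2 - F.p * F.q * hS

theorem X_eq (h : F.IsSymmetry φ) :
    F.X φ - (1 + F.p * F.p) * F.Z (F.P φ) - F.q * F.X (F.Q φ) = 0 := by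
  apply F.regular
  apply F.regular
  apply eq_zero_of_two_mul
  have hL2 := h.linS
  have hL3 := h.linT
  have hN1 := h.normal_P
  have hS := h.trace_eq
  simp only [trace, legendre, map_add, map_sub, map_neg, map_zero, Derivation.leibniz, smul_eq_mul,
    Derivation.map_one_eq_zero, derivation_two, X_p, Y_p, Z_p, P_p, Q_p, X_q, Y_q, Z_q, P_q, Q_q,
    Y_X, Z_X, P_X, Q_X, Z_Y, P_Y, Q_Y, P_Z, Q_Z, Q_P] at hL2 hL3 hN1 hS
  linear_combination -2 * F.q * hL2 + F.p * hL3 - 2 * (1 + F.p * F.p) * hN1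
    - F.p * (1 + F.p * F.p) * hS

theorem Y_eq (h : F.IsSymmetry φ) :
    F.Y φ - (1 + F.q * F.q) * F.Z (F.Q φ) - F.p * F.Y (F.P φ) = 0 := by
  apply F.regular
  apply F.regular
  apply eq_zero_of_two_mul
  have hL1 := h.linR
  have hL2 := h.linS
  have hN2 := h.normal_Q
  have hS := h.trace_eq
  simp only [trace, legendre, map_add, map_sub, map_neg, map_zero, Derivation.leibniz, smul_eq_mul,
    Derivation.map_one_eq_zero, derivation_two, X_p, Y_p, Z_p, P_p, Q_p, X_q, Y_q, Z_q, P_q, Q_q,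
    Y_X, Z_X, P_X, Q_X, Z_Y, P_Y, Q_Y, P_Z, Q_Z, Q_P] at hL1 hL2 hN2 hS
  linear_combination F.q * hL1 - 2 * F.p * hL2 - 2 * (1 + F.q * F.q) * hN2
    - F.q * (1 + F.q * F.q) * hS

/-- Eliminating YPQφ between P of `Y_Q` and Q of `Y_eq` gives p² ZPPφ + 2pq ZPQφ + (1 + q²) ZQQφ =
0, which differs from Z of `quad` by ZPPφ alone. `Z_Q_Q` is the mirror image. -/
theorem Z_P_P (h : F.IsSymmetry φ) :
    F.Z (F.P (F.P φ)) = 0 := by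
  have hPX3 := congrArg F.P h.Y_Q
  have hQU2 := congrArg F.Q h.Y_eq
  have hX3 := h.Y_Q
  have hZE := congrArg F.Z h.quad
  simp only [trace, legendre, map_add, map_sub, map_neg, map_zero, Derivation.leibniz, smul_eq_mul,
    Derivation.map_one_eq_zero, derivation_two, X_p, Y_p, Z_p, P_p, Q_p, X_q, Y_q, Z_q, P_q, Q_q,
    Y_X, Z_X, P_X, Q_X, Z_Y, P_Y, Q_Y, P_Z, Q_Z, Q_P] at hPX3 hQU2 hX3 hZE
  linear_combination F.p * hPX3 + hQU2 - hX3 + hZE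

theorem Z_P_Q (h : F.IsSymmetry φ) :
    F.Z (F.P (F.Q φ)) = 0 := by
  apply eq_zero_of_two_mul
  have hPR3 := congrArg F.P h.X_Q_add_Y_P
  have hPU2 := congrArg F.P h.Y_eq
  have hPX3 := congrArg F.P h.Y_Q
  have hQR3 := congrArg F.Q h.X_Q_add_Y_P
  have hQU1 := congrArg F.Q h.X_eq
  have hQX2 := congrArg F.Q h.X_P
  simp only [trace, legendre, map_add, map_sub, map_neg, map_zero, Derivation.leibniz, smul_eq_mul,
    Derivation.map_one_eq_zero, derivation_two, X_p, Y_p, Z_p, P_p, Q_p, X_q, Y_q, Z_q, P_q, Q_q,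
    Y_X, Z_X, P_X, Q_X, Z_Y, P_Y, Q_Y, P_Z, Q_Z, Q_P] at hPR3 hPU2 hPX3 hQR3 hQU1 hQX2
  linear_combination -F.p * hPR3 - hPU2 + F.q * hPX3 - F.q * hQR3 - hQU1 + F.p * hQX2

theorem Z_Q_Q (h : F.IsSymmetry φ) :
    F.Z (F.Q (F.Q φ)) = 0 := by
  have hPU1 := congrArg F.P h.X_eq
  have hQX2 := congrArg F.Q h.X_P
  have hX2 := h.X_P
  have hZE := congrArg F.Z h.quad
  simp only [trace, legendre, map_add, map_sub, map_neg, map_zero, Derivation.leibniz, smul_eq_mul,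
    Derivation.map_one_eq_zero, derivation_two, X_p, Y_p, Z_p, P_p, Q_p, X_q, Y_q, Z_q, P_q, Q_q,
    Y_X, Z_X, P_X, Q_X, Z_Y, P_Y, Q_Y, P_Z, Q_Z, Q_P] at hPU1 hQX2 hX2 hZE
  linear_combination hPU1 + F.q * hQX2 - hX2 + hZE

/-- Together with `X_Q_Q`, this makes p ZQφ - XQφ constant in the slopes; it becomes the coefficient
of the rotation y u_x - x u_y. -/
theorem X_P_Q (h : F.IsSymmetry φ) :
    F.X (F.P (F.Q φ)) = 0 := by
  have hPR3 := congrArg F.P h.X_Q_add_Y_P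
  have hPU1 := congrArg F.P h.X_eq
  have hPU2 := congrArg F.P h.Y_eq
  have hPX3 := congrArg F.P h.Y_Q
  have hQR3 := congrArg F.Q h.X_Q_add_Y_P
  have hQU1 := congrArg F.Q h.X_eq
  have hQX2 := congrArg F.Q h.X_P
  have hX2 := h.X_P
  have hZE := congrArg F.Z h.quad
  simp only [trace, legendre, map_add, map_sub, map_neg, map_zero, Derivation.leibniz, smul_eq_mul,
    Derivation.map_one_eq_zero, derivation_two, X_p, Y_p, Z_p, P_p, Q_p, X_q, Y_q, Z_q, P_q, Q_q,
    Y_X, Z_X, P_X, Q_X, Z_Y, P_Y, Q_Y, P_Z, Q_Z, Q_P] at hPR3 hPU1 hPU2 hPX3 hQR3 hQU1 hQX2 hX2 hZE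
  linear_combination -F.p * F.p * hPR3 + F.q * hPU1 - F.p * hPU2 + F.p * F.q * hPX3
    - F.p * F.q * hQR3 - F.p * hQU1
    + (1 + F.p * F.p + F.q * F.q) * hQX2 - F.q * hX2 + F.q * hZE

theorem X_Q_Q (h : F.IsSymmetry φ) :
    F.X (F.Q (F.Q φ)) = 0 := by
  have hPU1 := congrArg F.P h.X_eq
  have hPX2 := congrArg F.P h.X_P
  have hQU1 := congrArg F.Q h.X_eq
  have hX2 := h.X_P
  have hXE := congrArg F.X h.quad
  simp only [trace, legendre, map_add, map_sub, map_neg, map_zero, Derivation.leibniz, smul_eq_mul,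
    Derivation.map_one_eq_zero, derivation_two, X_p, Y_p, Z_p, P_p, Q_p, X_q, Y_q, Z_q, P_q, Q_q,
    Y_X, Z_X, P_X, Q_X, Z_Y, P_Y, Q_Y, P_Z, Q_Z, Q_P] at hPU1 hPX2 hQU1 hX2 hXE
  linear_combination 2 * F.p * hPU1 - (1 + F.p * F.p) * hPX2 + F.q * hQU1 - 2 * F.p * hX2 + hXE

end IsSymmetry

/-! ### Normal forms and their brackets -/

/-- The normal form of a contact symmetry: up to a solution of the Legendre transformed equation,
it is the combination with coefficients `a, b, c, d` of the three rotations and the dilatation. -/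
structure IsNormal (φ : R) (a b c d : ℝ) : Prop where
  X_eq : F.X φ = - algebraMap ℝ R a * F.q + algebraMap ℝ R b * (1 + F.p * F.p)
    + algebraMap ℝ R c * (F.p * F.q)
  Y_eq : F.Y φ = algebraMap ℝ R a * F.p + algebraMap ℝ R b * (F.p * F.q)
    + algebraMap ℝ R c * (1 + F.q * F.q)
  Z_eq : F.Z φ = algebraMap ℝ R b * F.p + algebraMap ℝ R c * F.q + algebraMap ℝ R d
  legendre_eq : F.legendre φ = 0

variable {F} {φ ψ : R}

theorem IsSymmetry.exists_isNormal (h : F.IsSymmetry φ)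
    (hconst : ∀ f, F.X f = 0 → F.Y f = 0 → F.Z f = 0 → F.P f = 0 → F.Q f = 0 →
      ∃ r : ℝ, f = algebraMap ℝ R r) :
    ∃ a b c d, F.IsNormal φ a b c d := by
  have hXX := h.X_X
  have hXY := h.X_Y
  have hYY := h.Y_Y
  have hXZ := h.X_Z
  have hYZ := h.Y_Z
  have hZZ := h.Z_Z
  have hPP := h.Z_P_P
  have hPQ := h.Z_P_Q
  have hQQ := h.Z_Q_Q
  have hXPQ := h.X_P_Q
  have hXQQ := h.X_Q_Q
  have hPXZ := congrArg F.P hXZ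
  have hQXZ := congrArg F.Q hXZ
  have hPYZ := congrArg F.P hYZ
  have hQYZ := congrArg F.Q hYZ
  have hPZZ := congrArg F.P hZZ
  have hQZZ := congrArg F.Q hZZ
  have hQXX := congrArg F.Q hXX
  have hQXY := congrArg F.Q hXY
  simp only [map_add, map_zero, P_X, Q_X, P_Y, Q_Y, P_Z, Q_Z]
    at hPXZ hQXZ hPYZ hQYZ hPZZ hQZZ hQXX hQXY
  simp only [hXZ, hZZ, add_zero] at hPXZ hQYZ hQXY
  -- The four constants are read off from the desired normal form: P and Q of Zφ = bp + cq + d give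
  -- b and c, then d is the remainder, and Q of Xφ gives XQφ = cp - a.
  obtain ⟨b, hb⟩ := hconst (F.Z (F.P φ)) hPXZ hPYZ hPZZ (by simpa using hPP) (by simpa using hPQ)
  obtain ⟨c, hc⟩ := hconst (F.Z (F.Q φ)) hQXZ hQYZ hQZZ (by simpa using hPQ) (by simpa using hQQ)
  obtain ⟨a, ha⟩ := hconst (F.p * F.Z (F.Q φ) - F.X (F.Q φ))
    (by simp [hQXZ, hQXX]) (by simp [hQYZ, hQXY]) (by simp [hQZZ, hQXZ])
    (by simp [hPQ, hXPQ]) (by simp [hQQ, hXQQ])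
  obtain ⟨d, hd⟩ := hconst (F.Z φ - F.p * F.Z (F.P φ) - F.q * F.Z (F.Q φ))
    (by simp [hXZ, hPXZ, hQXZ]) (by simp [hYZ, hPYZ, hQYZ]) (by simp [hZZ, hPZZ, hQZZ])
    (by simp [hPP, hPQ]) (by simp [hPQ, hQQ])
  refine ⟨a, b, c, d, ?_, ?_, ?_, h.quad⟩
  · rw [← ha, ← hb, ← hc]
    linear_combination h.X_eq
  · rw [← ha, ← hb, ← hc]
    linear_combination h.Y_eq + F.p * h.X_Q_add_Y_P
  · rw [← hb, ← hc, ← hd]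
    ring

namespace IsNormal

variable {a b c d a' b' c' d' : ℝ}

/-- Apart from `quad`, the determining equations involve only Xφ, Yφ, Zφ and their derivatives,
since XPφ = PXφ - Zφ and YQφ = QYφ - Zφ. -/
theorem isSymmetry (h : F.IsNormal φ a b c d) : F.IsSymmetry φ := by
  have hX := h.X_eq
  have hY := h.Y_eq
  have hZ := h.Z_eq
  have hXX := congrArg F.X hX
  have hXY := congrArg F.X hY
  have hYY := congrArg F.Y hY
  have hPX := congrArg F.P hX
  have hQX := congrArg F.Q hX
  have hPY := congrArg F.P hY
  have hQY := congrArg F.Q hY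
  simp only [map_add, map_neg, Derivation.leibniz, smul_eq_mul,
    Derivation.map_one_eq_zero, Derivation.map_algebraMap, X_p, Y_p, P_p, Q_p, X_q, Y_q, P_q, Q_q,
    P_X, Q_X, P_Y, Q_Y] at hXX hXY hYY hPX hQX hPY hQY
  rw [← eq_sub_iff_add_eq] at hPX hQY
  refine ⟨?_, h.legendre_eq, ?_, ?_, ?_⟩
  · rw [hXX, hXY, hYY]
    ring
  all_goals
    simp only [trace, hPX, hQX, hPY, hQY, hX, hY, hZ]
    ring

theorem add (h : F.IsNormal φ a b c d) (h' : F.IsNormal ψ a' b' c' d') :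
    F.IsNormal (φ + ψ) (a + a') (b + b') (c + c') (d + d') := by
  constructor
  · simp only [map_add, h.X_eq, h'.X_eq]
    ring
  · simp only [map_add, h.Y_eq, h'.Y_eq]
    ring
  · simp only [map_add, h.Z_eq, h'.Z_eq]
    ring
  · have e := h.legendre_eq
    have e' := h'.legendre_eq
    simp only [legendre, map_add] at e e' ⊢
    linear_combination e + e'

theorem smul (r : ℝ) (h : F.IsNormal φ a b c d) :
    F.IsNormal (r • φ) (r * a) (r * b) (r * c) (r * d) := by
  constructor
  · simp only [Derivation.map_smul, map_mul, h.X_eq]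
    simp only [Algebra.smul_def]
    ring
  · simp only [Derivation.map_smul, map_mul, h.Y_eq]
    simp only [Algebra.smul_def]
    ring
  · simp only [Derivation.map_smul, map_mul, h.Z_eq]
    simp only [Algebra.smul_def]
    ring
  · have e := h.legendre_eq
    simp only [legendre, Derivation.map_smul] at e ⊢
    simp only [Algebra.smul_def]
    linear_combination algebraMap ℝ R r * e

theorem congr (h : F.IsNormal φ a b c d) (ha : a = a') (hb : b = b') (hc : c = c') (hd : d = d') :
    F.IsNormal φ a' b' c' d' := by
  subst ha hb hc hd
  exact h

theorem X_eq_zero (h : F.IsNormal φ 0 0 0 0) : F.X φ = 0 := by simpa using h.X_eq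

theorem Y_eq_zero (h : F.IsNormal φ 0 0 0 0) : F.Y φ = 0 := by simpa using h.Y_eq

theorem Z_eq_zero (h : F.IsNormal φ 0 0 0 0) : F.Z φ = 0 := by simpa using h.Z_eq

theorem X_P_eq_zero (h : F.IsNormal φ 0 0 0 0) : F.X (F.P φ) = 0 := by
  simpa [h.X_eq_zero, h.Z_eq_zero] using (F.P_X φ).symm

theorem Y_P_eq_zero (h : F.IsNormal φ 0 0 0 0) : F.Y (F.P φ) = 0 := by
  simpa [h.Y_eq_zero] using (F.P_Y φ).symm

theorem Z_P_eq_zero (h : F.IsNormal φ 0 0 0 0) : F.Z (F.P φ) = 0 := by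
  simpa [h.Z_eq_zero] using (F.P_Z φ).symm

theorem X_Q_eq_zero (h : F.IsNormal φ 0 0 0 0) : F.X (F.Q φ) = 0 := by
  simpa [h.X_eq_zero] using (F.Q_X φ).symm

theorem Y_Q_eq_zero (h : F.IsNormal φ 0 0 0 0) : F.Y (F.Q φ) = 0 := by
  simpa [h.Y_eq_zero, h.Z_eq_zero] using (F.Q_Y φ).symm

theorem Z_Q_eq_zero (h : F.IsNormal φ 0 0 0 0) : F.Z (F.Q φ) = 0 := by
  simpa [h.Z_eq_zero] using (F.Q_Z φ).symm

end IsNormal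

variable (F) in
/-- The Jacobi bracket. -/
def bracket (φ ψ : R) : R :=
  φ * F.Z ψ - ψ * F.Z φ + F.X φ * F.P ψ - F.X ψ * F.P φ + F.Y φ * F.Q ψ - F.Y ψ * F.Q φ

-- The new triple is minus the cross product of (a, b, c) and (a', b', c'), the structure of so(3);
-- the dilatation commutes with the rotations, whence the last zero.
set_option linter.unusedSimpArgs false in
theorem IsNormal.bracket {a b c d a' b' c' d' : ℝ} (h : F.IsNormal φ a b c d)
    (h' : F.IsNormal ψ a' b' c' d') :
    F.IsNormal (F.bracket φ ψ) (b' * c - b * c') (a * c' - a' * c) (a' * b - a * b') 0 := by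
  have hPX : F.X (F.P φ) = F.P (F.X φ) - F.Z φ := by simp
  have hPX' : F.X (F.P ψ) = F.P (F.X ψ) - F.Z ψ := by simp
  have hQX : F.X (F.Q φ) = F.Q (F.X φ) := by simp
  have hQX' : F.X (F.Q ψ) = F.Q (F.X ψ) := by simp
  have hPY : F.Y (F.P φ) = F.P (F.Y φ) := by simp
  have hPY' : F.Y (F.P ψ) = F.P (F.Y ψ) := by simp
  have hQY : F.Y (F.Q φ) = F.Q (F.Y φ) - F.Z φ := by simp
  have hQY' : F.Y (F.Q ψ) = F.Q (F.Y ψ) - F.Z ψ := by simp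
  have hPZ : F.Z (F.P φ) = F.P (F.Z φ) := by simp
  have hPZ' : F.Z (F.P ψ) = F.P (F.Z ψ) := by simp
  have hQZ : F.Z (F.Q φ) = F.Q (F.Z φ) := by simp
  have hQZ' : F.Z (F.Q ψ) = F.Q (F.Z ψ) := by simp
  have hb : F.bracket φ ψ = φ * F.Z ψ - ψ * F.Z φ + F.X φ * F.P ψ - F.X ψ * F.P φ
    + F.Y φ * F.Q ψ - F.Y ψ * F.Q φ := rfl
  constructor
  · rw [hb]
    simp only [map_add, map_sub, map_neg, map_mul, Derivation.leibniz, smul_eq_mul,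
      Derivation.map_one_eq_zero, Derivation.map_algebraMap, X_p, P_p, Q_p, X_q, P_q, Q_q,
      hPX, hPX', hQX, hQX', hPY, hPY', hQY, hQY', h.X_eq, h.Y_eq, h.Z_eq, h'.X_eq, h'.Y_eq, h'.Z_eq]
    ring
  · rw [hb]
    simp only [map_add, map_sub, map_neg, map_mul, Derivation.leibniz, smul_eq_mul,
      Derivation.map_one_eq_zero, Derivation.map_algebraMap, Y_p, P_p, Q_p, Y_q, P_q, Q_q,
      hPX, hPX', hQX, hQX', hPY, hPY', hQY, hQY', h.X_eq, h.Y_eq, h.Z_eq, h'.X_eq, h'.Y_eq, h'.Z_eq]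
    ring
  · rw [hb]
    simp only [map_add, map_sub, map_neg, map_mul, map_zero, Derivation.leibniz, smul_eq_mul,
      Derivation.map_one_eq_zero, Derivation.map_algebraMap, Z_p, P_p, Q_p, Z_q, P_q, Q_q,
      hPZ, hPZ', hQZ, hQZ', h.X_eq, h.Y_eq, h.Z_eq, h'.X_eq, h'.Y_eq, h'.Z_eq]
    ring
  · have e := h.legendre_eq
    have e' := h'.legendre_eq
    have eP := congrArg F.P e
    have eP' := congrArg F.P e'
    have eQ := congrArg F.Q e
    have eQ' := congrArg F.Q e'
    simp only [legendre, map_add, map_zero, Derivation.leibniz, smul_eq_mul, derivation_two,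
      Derivation.map_one_eq_zero, P_p, Q_p, P_q, Q_q, Q_P] at e e' eP eP' eQ eQ'
    rw [hb, h.X_eq, h.Y_eq, h.Z_eq, h'.X_eq, h'.Y_eq, h'.Z_eq]
    simp only [legendre, map_add, map_sub, map_neg, map_zero, Derivation.leibniz, smul_eq_mul,
      Derivation.map_one_eq_zero, Derivation.map_algebraMap, P_p, Q_p, P_q, Q_q, Q_P]
    -- The bracket is T_φ ψ - T_ψ φ with T_φ = Xφ P + Yφ Q - Zφ, and the Legendre operator E
    -- satisfies E T_φ = T_φ E + 2(bp + cq) E.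
    linear_combination
      (- algebraMap ℝ R a * F.q + algebraMap ℝ R b * (1 + F.p * F.p)
      + algebraMap ℝ R c * (F.p * F.q)) * eP'
      + (algebraMap ℝ R a * F.p + algebraMap ℝ R b * (F.p * F.q)
      + algebraMap ℝ R c * (1 + F.q * F.q)) * eQ'
      + (algebraMap ℝ R b * F.p + algebraMap ℝ R c * F.q - algebraMap ℝ R d) * e'
      - (- algebraMap ℝ R a' * F.q + algebraMap ℝ R b' * (1 + F.p * F.p)
      + algebraMap ℝ R c' * (F.p * F.q)) * eP
      - (algebraMap ℝ R a' * F.p + algebraMap ℝ R b' * (F.p * F.q)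
      + algebraMap ℝ R c' * (1 + F.q * F.q)) * eQ
      - (algebraMap ℝ R b' * F.p + algebraMap ℝ R c' * F.q - algebraMap ℝ R d') * e

end ContactFrame

/-! ### The contact frame of the smooth functions on an open set -/

variable {U : TopologicalSpace.Opens Jet1}

open Classical in
/-- The extension by zero of a function on `U`. -/
noncomputable def extendZero (f : U → ℝ) : Jet1 → ℝ := fun z => if h : z ∈ U then f ⟨z, h⟩ else 0

theorem extendZero_of_mem (f : U → ℝ) {z : Jet1} (hz : z ∈ U) : extendZero f z = f ⟨z, hz⟩ :=
  dif_pos hz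

theorem extendZero_restrict (f : Jet1 → ℝ) :
    Set.EqOn (extendZero fun z : U => f z) f U := fun _ hz => extendZero_of_mem _ hz

variable (U) in
/-- The algebra of smooth functions on `U`. -/
def smoothAlgebra : Subalgebra ℝ (U → ℝ) where
  carrier := {f | ContDiffOn ℝ ∞ (extendZero f) U}
  mul_mem' {f g} hf hg := (ContDiffOn.mul hf hg).congr fun z hz => by
    simp [extendZero_of_mem _ hz]
  add_mem' {f g} hf hg := (ContDiffOn.add hf hg).congr fun z hz => by
    simp [extendZero_of_mem _ hz]
  algebraMap_mem' r := (contDiffOn_const (c := r)).congr fun z hz => by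
    simp [extendZero_of_mem _ hz]

/-- The element of the algebra given by a function on the first jets that is smooth on `U`. -/
def smoothAlgebra.ofContDiffOn (f : Jet1 → ℝ) (hf : ContDiffOn ℝ ∞ f U) : smoothAlgebra U :=
  ⟨fun z => f z, hf.congr (extendZero_restrict f)⟩

namespace smoothAlgebra

@[simp]
theorem ofContDiffOn_apply (f : Jet1 → ℝ) (hf : ContDiffOn ℝ ∞ f U) (z : U) :
    (ofContDiffOn f hf).1 z = f z := rfl

@[simp]
theorem add_apply (f g : smoothAlgebra U) (z : U) : (f + g).1 z = f.1 z + g.1 z := rfl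

@[simp]
theorem sub_apply (f g : smoothAlgebra U) (z : U) : (f - g).1 z = f.1 z - g.1 z := rfl

@[simp]
theorem neg_apply (f : smoothAlgebra U) (z : U) : (-f).1 z = -f.1 z := rfl

@[simp]
theorem mul_apply (f g : smoothAlgebra U) (z : U) : (f * g).1 z = f.1 z * g.1 z := rfl

@[simp]
theorem zero_apply (z : U) : (0 : smoothAlgebra U).1 z = 0 := rfl

@[simp]
theorem one_apply (z : U) : (1 : smoothAlgebra U).1 z = 1 := rfl

@[simp]
theorem two_apply (z : U) : (2 : smoothAlgebra U).1 z = 2 := rfl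

@[simp]
theorem algebraMap_apply (r : ℝ) (z : U) : (algebraMap ℝ (smoothAlgebra U) r).1 z = r := rfl

theorem ext {f g : smoothAlgebra U} (h : ∀ z, f.1 z = g.1 z) : f = g :=
  Subtype.ext (funext h)

theorem ext_iff {f g : smoothAlgebra U} : f = g ↔ ∀ z, f.1 z = g.1 z :=
  ⟨fun h _ => h ▸ rfl, ext⟩

theorem contDiffOn (f : smoothAlgebra U) : ContDiffOn ℝ ∞ (extendZero f.1) U := f.2

theorem differentiableAt (f : smoothAlgebra U) (z : U) :
    DifferentiableAt ℝ (extendZero f.1) z := differentiableAt_of_smooth f.2 z.2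

/-- The partial derivative with respect to the `i`-th coordinate, as a derivation. -/
noncomputable def partialDeriv (i : Fin 5) : Derivation ℝ (smoothAlgebra U) (smoothAlgebra U) :=
  Derivation.mk'
    { toFun := fun f => ofContDiffOn (pd i (extendZero f.1)) (pd_smooth i (contDiffOn f))
      map_add' := fun f g => ext fun z => by
        simp only [ofContDiffOn_apply, add_apply]
        rw [← pd_add i (differentiableAt f z) (differentiableAt g z)]
        exact pd_congr i (fun w hw => by simp [extendZero_of_mem _ hw]) z.2
      map_smul' := fun c f => ext fun z => by
        have h : pd i (extendZero (c • f).1) z = pd i (fun w => c * extendZero f.1 w) z :=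
          pd_congr i (fun w hw => by simp [extendZero_of_mem _ hw]) z.2
        have hc : pd i (fun w => c * extendZero f.1 w) z = c * pd i (extendZero f.1) z := by
          simp [pd, fderiv_const_mul (differentiableAt f z)]
        exact h.trans hc }
    fun f g => ext fun z => by
      have h : pd i (extendZero (f * g).1) z
          = pd i (fun w => extendZero f.1 w * extendZero g.1 w) z :=
        pd_congr i (fun w hw => by simp [extendZero_of_mem _ hw]) z.2
      have hm := pd_mul i (differentiableAt f z) (differentiableAt g z)
      simp only [extendZero_of_mem _ z.2] at hm
      exact h.trans hm

theorem partialDeriv_ofContDiffOn (i : Fin 5) (f : Jet1 → ℝ) (hf : ContDiffOn ℝ ∞ f U) :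
    partialDeriv i (ofContDiffOn f hf) = ofContDiffOn (pd i f) (pd_smooth i hf) :=
  ext fun z => pd_congr i (extendZero_restrict f) z.2

theorem eq_ofContDiffOn (f : smoothAlgebra U) : f = ofContDiffOn (extendZero f.1) (contDiffOn f) :=
  ext fun z => (extendZero_of_mem f.1 z.2).symm

theorem partialDeriv_comm (i j : Fin 5) (f : smoothAlgebra U) :
    partialDeriv i (partialDeriv j f) = partialDeriv j (partialDeriv i f) := by
  rw [eq_ofContDiffOn f]
  simp only [partialDeriv_ofContDiffOn]
  exact ext fun z => pd_comm i j (contDiffOn f) z.2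

variable (U) in
/-- The coordinate functions on `U`. -/
def coord (i : Fin 5) : smoothAlgebra U := ofContDiffOn (fun z => z i) (coord_smooth i)

@[simp]
theorem coord_apply (i : Fin 5) (z : U) : (coord U i).1 z = z.1 i := rfl

theorem partialDeriv_coord (i j : Fin 5) :
    partialDeriv i (coord U j) = if j = i then 1 else 0 := by
  rw [coord, partialDeriv_ofContDiffOn]
  refine ext fun z => (pd_coord i j).trans ?_
  split_ifs <;> rfl

variable (U) in
/-- The contact frame of the first jets. -/
noncomputable def frame : ContactFrame (smoothAlgebra U) where
  X := partialDeriv 0 + coord U 3 • partialDeriv 2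
  Y := partialDeriv 1 + coord U 4 • partialDeriv 2
  Z := partialDeriv 2
  P := partialDeriv 3
  Q := partialDeriv 4
  p := coord U 3
  q := coord U 4
  X_p := by simp [partialDeriv_coord]
  Y_p := by simp [partialDeriv_coord]
  Z_p := by simp [partialDeriv_coord]
  P_p := by simp [partialDeriv_coord]
  Q_p := by simp [partialDeriv_coord]
  X_q := by simp [partialDeriv_coord]
  Y_q := by simp [partialDeriv_coord]
  Z_q := by simp [partialDeriv_coord]
  P_q := by simp [partialDeriv_coord]
  Q_q := by simp [partialDeriv_coord]
  Y_X f := by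
    simp [partialDeriv_coord, partialDeriv_comm 1 0, partialDeriv_comm 2 0, partialDeriv_comm 2 1]
    ring
  Z_X f := by simp [partialDeriv_coord, partialDeriv_comm 2 0]
  P_X f := by
    simp [partialDeriv_coord, partialDeriv_comm 3 0, partialDeriv_comm 3 2]
    ring
  Q_X f := by simp [partialDeriv_coord, partialDeriv_comm 4 0, partialDeriv_comm 4 2]
  Z_Y f := by simp [partialDeriv_coord, partialDeriv_comm 2 1]
  P_Y f := by simp [partialDeriv_coord, partialDeriv_comm 3 1, partialDeriv_comm 3 2]
  Q_Y f := by
    simp [partialDeriv_coord, partialDeriv_comm 4 1, partialDeriv_comm 4 2]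
    ring
  P_Z f := partialDeriv_comm 3 2 f
  Q_Z f := partialDeriv_comm 4 2 f
  Q_P f := partialDeriv_comm 4 3 f
  regular f hf := ext fun z => by
    have h : (1 + z.1 3 * z.1 3 + z.1 4 * z.1 4) * f.1 z = 0 := ext_iff.1 hf z
    have hpos : 1 + z.1 3 * z.1 3 + z.1 4 * z.1 4 ≠ 0 :=
      ne_of_gt (by nlinarith [mul_self_nonneg (z.1 3), mul_self_nonneg (z.1 4)])
    exact (mul_eq_zero.1 h).resolve_left hpos

theorem fderiv_eq_zero {f : Jet1 → ℝ} {z : Jet1} (h : ∀ i, pd i f z = 0) : fderiv ℝ f z = 0 := by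
  refine ContinuousLinearMap.coe_injective (LinearMap.pi_ext' fun i => LinearMap.ext_ring ?_)
  simpa [pd] using h i

theorem exists_eq_algebraMap (hU : IsPreconnected (U : Set Jet1)) (f : smoothAlgebra U)
    (hX : (frame U).X f = 0) (hY : (frame U).Y f = 0) (hZ : (frame U).Z f = 0)
    (hP : (frame U).P f = 0) (hQ : (frame U).Q f = 0) :
    ∃ r : ℝ, f = algebraMap ℝ (smoothAlgebra U) r := by
  have h2 : partialDeriv 2 f = 0 := hZ
  have h0 : partialDeriv 0 f = 0 := by
    have : partialDeriv 0 f + coord U 3 * partialDeriv 2 f = 0 := hX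
    rwa [h2, mul_zero, add_zero] at this
  have h1 : partialDeriv 1 f = 0 := by
    have : partialDeriv 1 f + coord U 4 * partialDeriv 2 f = 0 := hY
    rwa [h2, mul_zero, add_zero] at this
  have hi : ∀ i, partialDeriv i f = 0 := by
    intro i
    fin_cases i
    exacts [h0, h1, h2, hP, hQ]
  obtain ⟨r, hr⟩ := U.isOpen.exists_is_const_of_fderiv_eq_zero hU
    (f := extendZero f.1) (𝕜 := ℝ) (fun z hz => (differentiableAt f ⟨z, hz⟩).differentiableWithinAt)
    (fun z hz => fderiv_eq_zero fun i => ext_iff.1 (hi i) ⟨z, hz⟩)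
  exact ⟨r, ext fun z => (extendZero_of_mem f.1 z.2).symm.trans (hr z z.2)⟩

end smoothAlgebra

/-! ### Derivatives of functions pulled back to the second jets -/

section PartialDerivatives

variable {n : ℕ} {f g : (Fin n → ℝ) → ℝ} {z : Fin n → ℝ}

theorem pd_fun_add (i : Fin n) (hf : DifferentiableAt ℝ f z) (hg : DifferentiableAt ℝ g z) :
    pd i (fun w => f w + g w) z = pd i f z + pd i g z := by
  simp [pd, fderiv_fun_add hf hg]

theorem pd_fun_mul (i : Fin n) (hf : DifferentiableAt ℝ f z) (hg : DifferentiableAt ℝ g z) :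
    pd i (fun w => f w * g w) z = f z * pd i g z + g z * pd i f z := by
  simp [pd, fderiv_fun_mul hf hg]

theorem hasFDerivAt_coord (j : Fin n) :
    HasFDerivAt (fun w : Fin n → ℝ => w j) (ContinuousLinearMap.proj (R := ℝ) j) z :=
  (ContinuousLinearMap.proj (R := ℝ) (φ := fun _ : Fin n => ℝ) j).hasFDerivAt

theorem pd_fun_coord (i j : Fin n) :
    pd i (fun w : Fin n → ℝ => w j) z = if j = i then 1 else 0 := by
  simp [pd, (hasFDerivAt_coord j).fderiv, Pi.single_apply]

end PartialDerivatives

/-- The projection from second to first jets, as a continuous linear map. -/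
def toJet1L : Jet2 →L[ℝ] Jet1 :=
  ContinuousLinearMap.pi fun i => ContinuousLinearMap.proj (Fin.castLE (by decide) i)

theorem hasFDerivAt_toJet1 (θ : Jet2) : HasFDerivAt toJet1 toJet1L θ := toJet1L.hasFDerivAt

theorem toJet1L_single (j : Fin 5) (h : 5 ≤ 8) :
    toJet1L (Pi.single (Fin.castLE h j) 1) = Pi.single j 1 := by
  ext k
  simp [toJet1L, Pi.single_apply]

theorem toJet1L_single_of_le {i : Fin 8} (hi : 5 ≤ i.1) : toJet1L (Pi.single i 1) = 0 := by
  ext k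
  have : Fin.castLE (by decide) k ≠ i := fun h => by
    have := congrArg Fin.val h
    simp at this
    omega
  simp [toJet1L, this]

section

variable {f : Jet1 → ℝ} {θ : Jet2}

theorem differentiableAt_comp_toJet1 (hf : DifferentiableAt ℝ f (toJet1 θ)) :
    DifferentiableAt ℝ (fun η => f (toJet1 η)) θ :=
  (hf.hasFDerivAt.comp θ (hasFDerivAt_toJet1 θ)).differentiableAt

theorem pd_comp_toJet1_eq (i : Fin 8) (hf : DifferentiableAt ℝ f (toJet1 θ)) :
    pd i (fun η => f (toJet1 η)) θ = fderiv ℝ f (toJet1 θ) (toJet1L (Pi.single i 1)) := by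
  have := (hf.hasFDerivAt.comp θ (hasFDerivAt_toJet1 θ)).fderiv
  exact congrArg (fun L : Jet2 →L[ℝ] ℝ => L (Pi.single i 1)) this

theorem pd_comp_toJet1 (j : Fin 5) (h : 5 ≤ 8) (hf : DifferentiableAt ℝ f (toJet1 θ)) :
    pd (Fin.castLE h j) (fun η => f (toJet1 η)) θ = pd j f (toJet1 θ) := by
  rw [pd_comp_toJet1_eq _ hf, toJet1L_single, pd]

theorem pd_comp_toJet1_of_le {i : Fin 8} (hi : 5 ≤ i.1) (hf : DifferentiableAt ℝ f (toJet1 θ)) :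
    pd i (fun η => f (toJet1 η)) θ = 0 := by
  rw [pd_comp_toJet1_eq _ hf, toJet1L_single_of_le hi, map_zero]

/-- The chain rule for a combination of pulled back functions with coordinates as coefficients. -/
theorem pd_total {f₀ f₁ f₂ f₃ : Jet1 → ℝ} (a b c i : Fin 8)
    (h₀ : DifferentiableAt ℝ f₀ (toJet1 θ)) (h₁ : DifferentiableAt ℝ f₁ (toJet1 θ))
    (h₂ : DifferentiableAt ℝ f₂ (toJet1 θ)) (h₃ : DifferentiableAt ℝ f₃ (toJet1 θ)) :
    pd i (fun η => f₀ (toJet1 η) + η a * f₁ (toJet1 η) + η b * f₂ (toJet1 η)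
      + η c * f₃ (toJet1 η)) θ =
    pd i (fun η => f₀ (toJet1 η)) θ
      + (θ a * pd i (fun η => f₁ (toJet1 η)) θ + f₁ (toJet1 θ) * if a = i then 1 else 0)
      + (θ b * pd i (fun η => f₂ (toJet1 η)) θ + f₂ (toJet1 θ) * if b = i then 1 else 0)
      + (θ c * pd i (fun η => f₃ (toJet1 η)) θ + f₃ (toJet1 θ) * if c = i then 1 else 0) := by
  have e₀ := differentiableAt_comp_toJet1 h₀
  have e₁ := differentiableAt_comp_toJet1 h₁
  have e₂ := differentiableAt_comp_toJet1 h₂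
  have e₃ := differentiableAt_comp_toJet1 h₃
  have d := fun j : Fin 8 => (hasFDerivAt_coord (z := θ) j).differentiableAt
  rw [pd_fun_add i ((e₀.fun_add ((d a).fun_mul e₁)).fun_add ((d b).fun_mul e₂)) ((d c).fun_mul e₃),
    pd_fun_add i (e₀.fun_add ((d a).fun_mul e₁)) ((d b).fun_mul e₂),
    pd_fun_add i e₀ ((d a).fun_mul e₁), pd_fun_mul i (d a) e₁, pd_fun_mul i (d b) e₂,
    pd_fun_mul i (d c) e₃, pd_fun_coord, pd_fun_coord, pd_fun_coord]

end

theorem pd_minimalOperator (i : Fin 8) (θ : Jet2) :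
    pd i minimalOperator θ =
      (1 + θ 4 ^ 2) * (if (5 : Fin 8) = i then 1 else 0)
      + 2 * θ 4 * θ 5 * (if (4 : Fin 8) = i then 1 else 0)
      - 2 * θ 4 * θ 6 * (if (3 : Fin 8) = i then 1 else 0)
      - 2 * θ 3 * θ 6 * (if (4 : Fin 8) = i then 1 else 0)
      - 2 * θ 3 * θ 4 * (if (6 : Fin 8) = i then 1 else 0)
      + (1 + θ 3 ^ 2) * (if (7 : Fin 8) = i then 1 else 0)
      + 2 * θ 3 * θ 7 * (if (3 : Fin 8) = i then 1 else 0) := by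
  have p := fun j : Fin 8 => hasFDerivAt_coord (z := θ) j
  have h := (((((p 4).pow 2).const_add 1).mul (p 5)).sub
    ((((p 3).const_mul 2).mul (p 4)).mul (p 6))).add
    ((((p 3).pow 2).const_add 1).mul (p 7))
  have h' : HasFDerivAt minimalOperator _ θ := h
  rw [pd, h'.fderiv]
  simp [Pi.single_apply]
  ring_nf

/-! ### Restriction of the linearised operator to the equation -/

section Evolutionary

variable {φ : Jet1 → ℝ}

/-- The third derivatives of u enter only through φ_p D_xF + φ_q D_yF. Modulo F the quadratic terms
collapse; for instance φ_pp has the coefficient (1 + q²)r² - 2pq rs + (1 + p²)s² = rF + (1 + p²)(s²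
- rt). -/
theorem evolutionary₂_minimalOperator (hφ : ContDiffOn ℝ ∞ φ U) {θ : Jet3}
    (hθ : toJet1 (toJet2 θ) ∈ U) {z : Jet1} (hz : toJet1 (toJet2 θ) = z) :
    evolutionary₂ φ minimalOperator θ =
      ((1 + z 4 * z 4) * (pd 0 (pd 0 φ) z + 2 * z 3 * pd 0 (pd 2 φ) z
          + z 3 * z 3 * pd 2 (pd 2 φ) z)
        - 2 * z 3 * z 4 * (pd 0 (pd 1 φ) z + z 4 * pd 0 (pd 2 φ) z + z 3 * pd 1 (pd 2 φ) z
          + z 3 * z 4 * pd 2 (pd 2 φ) z)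
        + (1 + z 3 * z 3) * (pd 1 (pd 1 φ) z + 2 * z 4 * pd 1 (pd 2 φ) z
          + z 4 * z 4 * pd 2 (pd 2 φ) z))
      + 2 * ((z 4 * (pd 1 φ z + z 4 * pd 2 φ z)
          + (1 + z 4 * z 4) * (pd 0 (pd 3 φ) z + z 3 * pd 2 (pd 3 φ) z)
          - z 3 * z 4 * (pd 1 (pd 3 φ) z + z 4 * pd 2 (pd 3 φ) z)) * θ 5
        + (-(z 4 * (pd 0 φ z + z 3 * pd 2 φ z)) - z 3 * (pd 1 φ z + z 4 * pd 2 φ z)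
          + (1 + z 4 * z 4) * (pd 0 (pd 4 φ) z + z 3 * pd 2 (pd 4 φ) z)
          - z 3 * z 4 * (pd 1 (pd 4 φ) z + z 4 * pd 2 (pd 4 φ) z
            + (pd 0 (pd 3 φ) z + z 3 * pd 2 (pd 3 φ) z))
          + (1 + z 3 * z 3) * (pd 1 (pd 3 φ) z + z 4 * pd 2 (pd 3 φ) z)) * θ 6
        + (z 3 * (pd 0 φ z + z 3 * pd 2 φ z)
          - z 3 * z 4 * (pd 0 (pd 4 φ) z + z 3 * pd 2 (pd 4 φ) z)
          + (1 + z 3 * z 3) * (pd 1 (pd 4 φ) z + z 4 * pd 2 (pd 4 φ) z)) * θ 7)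
      + (θ 6 * θ 6 - θ 5 * θ 7) * ((1 + z 3 * z 3) * pd 3 (pd 3 φ) z
        + 2 * z 3 * z 4 * pd 3 (pd 4 φ) z + (1 + z 4 * z 4) * pd 4 (pd 4 φ) z)
      + (pd 2 φ z + θ 5 * pd 3 (pd 3 φ) z + 2 * θ 6 * pd 3 (pd 4 φ) z + θ 7 * pd 4 (pd 4 φ) z)
        * minimalOperator (toJet2 θ)
      + pd 3 φ z * totalX₂ minimalOperator θ + pd 4 φ z * totalY₂ minimalOperator θ := by
  subst hz
  have d := fun i => differentiableAt_of_smooth (pd_smooth i hφ) hθ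
  -- The indices 3, 5, 6 stand for u_x, u_xx, u_xy, the coefficients of ∂_u, ∂_p, ∂_q in D_x; for
  -- D_y they are 4, 6, 7.
  have tX : ∀ i, pd i (totalX₁ φ) (toJet2 θ) = _ := fun i =>
    pd_total 3 5 6 i (d 0) (d 2) (d 3) (d 4)
  have tY : ∀ i, pd i (totalY₁ φ) (toJet2 θ) = _ := fun i =>
    pd_total 4 6 7 i (d 1) (d 2) (d 3) (d 4)
  have e0 : ∀ j, pd 0 (fun η => pd j φ (toJet1 η)) (toJet2 θ) = pd 0 (pd j φ) (toJet1 (toJet2 θ)) :=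
    fun j => pd_comp_toJet1 0 (by decide) (d j)
  have e1 : ∀ j, pd 1 (fun η => pd j φ (toJet1 η)) (toJet2 θ) = pd 1 (pd j φ) (toJet1 (toJet2 θ)) :=
    fun j => pd_comp_toJet1 1 (by decide) (d j)
  have e2 : ∀ j, pd 2 (fun η => pd j φ (toJet1 η)) (toJet2 θ) = pd 2 (pd j φ) (toJet1 (toJet2 θ)) :=
    fun j => pd_comp_toJet1 2 (by decide) (d j)
  have e3 : ∀ j, pd 3 (fun η => pd j φ (toJet1 η)) (toJet2 θ) = pd 3 (pd j φ) (toJet1 (toJet2 θ)) :=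
    fun j => pd_comp_toJet1 3 (by decide) (d j)
  have e4 : ∀ j, pd 4 (fun η => pd j φ (toJet1 η)) (toJet2 θ) = pd 4 (pd j φ) (toJet1 (toJet2 θ)) :=
    fun j => pd_comp_toJet1 4 (by decide) (d j)
  have e5 : ∀ j, pd 5 (fun η => pd j φ (toJet1 η)) (toJet2 θ) = 0 :=
    fun j => pd_comp_toJet1_of_le (by decide) (d j)
  have e6 : ∀ j, pd 6 (fun η => pd j φ (toJet1 η)) (toJet2 θ) = 0 :=
    fun j => pd_comp_toJet1_of_le (by decide) (d j)
  have e7 : ∀ j, pd 7 (fun η => pd j φ (toJet1 η)) (toJet2 θ) = 0 :=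
    fun j => pd_comp_toJet1_of_le (by decide) (d j)
  have c := fun i j => pd_comm i j hφ hθ
  have z3 : toJet1 (toJet2 θ) 3 = θ 3 := rfl
  have z4 : toJet1 (toJet2 θ) 4 = θ 4 := rfl
  have w3 : toJet2 θ 3 = θ 3 := rfl
  have w4 : toJet2 θ 4 = θ 4 := rfl
  have w5 : toJet2 θ 5 = θ 5 := rfl
  have w6 : toJet2 θ 6 = θ 6 := rfl
  have w7 : toJet2 θ 7 = θ 7 := rfl
  simp only [evolutionary₂, totalX₂, totalY₂, tX, tY, e0, e1, e2, e3, e4, e5, e6, e7]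
  simp only [totalX₁, totalY₁, pd_minimalOperator, minimalOperator, z3, z4, w3, w4, w5, w6, w7,
    c 2 0, c 3 0, c 4 0, c 2 1, c 3 1, c 4 1, c 3 2, c 4 2, c 4 3, Fin.reduceEq, if_true,
    if_false]
  ring

end Evolutionary

/-- The linear part must be proportional to the equation of the plane. The factor is m / (2g):
contraction with (1 + p², pq, 1 + q²) sends (1 + q², -2pq, 1 + p²) to 2g, as (1 + p²)(1 + q²) - p²q²
= g. -/
theorem forall_quadratic_eq_zero_iff (p q c e l₁ l₂ l₃ m : ℝ)
    (hm : m = (1 + p * p) * l₁ + p * q * l₂ + (1 + q * q) * l₃) :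
    (∀ r s t : ℝ, (1 + q * q) * r - 2 * p * q * s + (1 + p * p) * t = 0 →
      c + 2 * (l₁ * r + l₂ * s + l₃ * t) + (s * s - r * t) * e = 0) ↔
    c = 0 ∧ e = 0 ∧ 2 * (1 + p * p + q * q) * l₁ = (1 + q * q) * m ∧
      (1 + p * p + q * q) * l₂ = -(p * q * m) ∧
      2 * (1 + p * p + q * q) * l₃ = (1 + p * p) * m := by
  have hA : (1 + q * q) ≠ 0 := ne_of_gt (by nlinarith [mul_self_nonneg q])
  have hD : (1 + p * p) ≠ 0 := ne_of_gt (by nlinarith [mul_self_nonneg p])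
  have hg : (1 + p * p + q * q) ≠ 0 :=
    ne_of_gt (by nlinarith [mul_self_nonneg p, mul_self_nonneg q])
  constructor
  · intro h
    have hc : c = 0 := by simpa using h 0 0 0 (by ring)
    -- Two vectors spanning the plane are tested, the first with both signs: the even part isolates
    -- e, the odd part the linear form.
    have h₁ := h (1 + p * p) 0 (-(1 + q * q)) (by ring)
    have h₂ := h (-(1 + p * p)) 0 (1 + q * q) (by ring)
    have h₃ := h (2 * p * q) (1 + q * q) 0 (by ring)
    have he : e = 0 := by
      have : (1 + p * p) * (1 + q * q) * e = 0 := by linear_combination (h₁ + h₂) / 2 - hc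
      exact (mul_eq_zero.1 this).resolve_left (mul_ne_zero hD hA)
    have k₁ : (1 + p * p) * l₁ - (1 + q * q) * l₃ = 0 := by linear_combination (h₁ - h₂) / 4
    have k₂ : 2 * p * q * l₁ + (1 + q * q) * l₂ = 0 := by
      linear_combination (h₃ - hc - (1 + q * q) * (1 + q * q) * he) / 2
    refine ⟨hc, he, ?_, ?_, ?_⟩
    · linear_combination (1 + q * q) * k₁ - p * q * k₂ - (1 + q * q) * hm
    · apply mul_left_cancel₀ hA
      linear_combination (1 + p * p + q * q + p * q * (p * q)) * k₂
        - p * q * (1 + q * q) * k₁ + p * q * (1 + q * q) * hm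
    · apply mul_left_cancel₀ hA
      linear_combination (-2 * (1 + p * p + q * q) + (1 + p * p) * (1 + q * q)) * k₁
        - (1 + p * p) * p * q * k₂ - (1 + q * q) * (1 + p * p) * hm
  · rintro ⟨hc, he, h₁, h₂, h₃⟩ r s t h
    apply mul_left_cancel₀ hg
    linear_combination (1 + p * p + q * q) * hc + (1 + p * p + q * q) * (s * s - r * t) * he
      + r * h₁ + 2 * s * h₂ + t * h₃ + m * h

/-! ### Contact symmetries as solutions of the determining equations -/

/-- A smooth function on `U` as an element of the algebra. -/
def SmoothFun.toAlgebra (φ : SmoothFun U) : smoothAlgebra U :=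
  smoothAlgebra.ofContDiffOn φ.1 φ.2.1

namespace smoothAlgebra

variable {φ : Jet1 → ℝ} (hφ : ContDiffOn ℝ ∞ φ U) (z : U)

theorem frame_X (f : smoothAlgebra U) :
    (frame U).X f = partialDeriv 0 f + coord U 3 * partialDeriv 2 f := rfl

theorem frame_Y (f : smoothAlgebra U) :
    (frame U).Y f = partialDeriv 1 f + coord U 4 * partialDeriv 2 f := rfl

theorem frame_Z (f : smoothAlgebra U) : (frame U).Z f = partialDeriv 2 f := rfl

theorem frame_P (f : smoothAlgebra U) : (frame U).P f = partialDeriv 3 f := rfl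

theorem frame_Q (f : smoothAlgebra U) : (frame U).Q f = partialDeriv 4 f := rfl

theorem frame_p : (frame U).p = coord U 3 := rfl

theorem frame_q : (frame U).q = coord U 4 := rfl

theorem X_X_apply : ((frame U).X ((frame U).X (ofContDiffOn φ hφ))).1 z =
    pd 0 (pd 0 φ) z + 2 * z.1 3 * pd 0 (pd 2 φ) z + z.1 3 * z.1 3 * pd 2 (pd 2 φ) z := by
  simp only [frame_X, map_add, Derivation.leibniz, smul_eq_mul, partialDeriv_coord,
    partialDeriv_comm 2 0]
  simp only [partialDeriv_ofContDiffOn, Fin.reduceEq, if_false, add_apply, mul_apply, zero_apply,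
    ofContDiffOn_apply, coord_apply]
  ring

theorem X_Y_apply : ((frame U).X ((frame U).Y (ofContDiffOn φ hφ))).1 z =
    pd 0 (pd 1 φ) z + z.1 4 * pd 0 (pd 2 φ) z + z.1 3 * pd 1 (pd 2 φ) z
      + z.1 3 * z.1 4 * pd 2 (pd 2 φ) z := by
  simp only [frame_X, frame_Y, map_add, Derivation.leibniz, smul_eq_mul, partialDeriv_coord,
    partialDeriv_comm 2 1]
  simp only [partialDeriv_ofContDiffOn, Fin.reduceEq, if_false, add_apply, mul_apply, zero_apply,
    ofContDiffOn_apply, coord_apply]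
  ring

theorem Y_Y_apply : ((frame U).Y ((frame U).Y (ofContDiffOn φ hφ))).1 z =
    pd 1 (pd 1 φ) z + 2 * z.1 4 * pd 1 (pd 2 φ) z + z.1 4 * z.1 4 * pd 2 (pd 2 φ) z := by
  simp only [frame_Y, map_add, Derivation.leibniz, smul_eq_mul, partialDeriv_coord,
    partialDeriv_comm 2 1]
  simp only [partialDeriv_ofContDiffOn, Fin.reduceEq, if_false, add_apply, mul_apply, zero_apply,
    ofContDiffOn_apply, coord_apply]
  ring

theorem X_apply : ((frame U).X (ofContDiffOn φ hφ)).1 z = pd 0 φ z + z.1 3 * pd 2 φ z := by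
  rw [frame_X, partialDeriv_ofContDiffOn, partialDeriv_ofContDiffOn]
  rfl

theorem Y_apply : ((frame U).Y (ofContDiffOn φ hφ)).1 z = pd 1 φ z + z.1 4 * pd 2 φ z := by
  rw [frame_Y, partialDeriv_ofContDiffOn, partialDeriv_ofContDiffOn]
  rfl

theorem Z_ofContDiffOn : (frame U).Z (ofContDiffOn φ hφ) = ofContDiffOn (pd 2 φ) (pd_smooth 2 hφ) :=
  partialDeriv_ofContDiffOn 2 φ hφ

theorem P_ofContDiffOn : (frame U).P (ofContDiffOn φ hφ) = ofContDiffOn (pd 3 φ) (pd_smooth 3 hφ) :=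
  partialDeriv_ofContDiffOn 3 φ hφ

theorem Q_ofContDiffOn : (frame U).Q (ofContDiffOn φ hφ) = ofContDiffOn (pd 4 φ) (pd_smooth 4 hφ) :=
  partialDeriv_ofContDiffOn 4 φ hφ

end smoothAlgebra

theorem exists_mem_minimalEquation (z : Jet1) (r s t : ℝ)
    (h : (1 + z 4 * z 4) * r - 2 * z 3 * z 4 * s + (1 + z 3 * z 3) * t = 0) :
    ∃ θ ∈ minimalEquation, toJet1 (toJet2 θ) = z ∧ θ 5 = r ∧ θ 6 = s ∧ θ 7 = t := by
  have hA : (1 + z 4 ^ 2) ≠ 0 := by positivity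
  have hD : (1 + z 3 ^ 2) ≠ 0 := by positivity
  -- Here k = ∂F/∂u_x and l = ∂F/∂u_y. With u_xxy = u_xyy = 0, the equation D_xF = 0 is solved for
  -- u_xxx and D_yF = 0 for u_yyy, whose coefficients 1 + q² and 1 + p² do not vanish.
  let k := 2 * z 3 * t - 2 * z 4 * s
  let l := 2 * z 4 * r - 2 * z 3 * s
  refine ⟨![z 0, z 1, z 2, z 3, z 4, r, s, t, -(r * k + s * l) / (1 + z 4 ^ 2), 0, 0,
    -(s * k + t * l) / (1 + z 3 ^ 2)], ⟨?_, ?_, ?_⟩, ?_, rfl, rfl, rfl⟩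
  · change (1 + z 4 ^ 2) * r - 2 * z 3 * z 4 * s + (1 + z 3 ^ 2) * t = 0
    linear_combination h
  · simp only [totalX₂, pd_minimalOperator, Fin.reduceEq, if_true, if_false]
    simp only [toJet2]
    change _ + z 3 * _ + r * (_ * 0 + 2 * z 4 * r * 0 - 2 * z 4 * s * 1 - 2 * z 3 * s * 0 - _ * 0
      + _ * 0 + 2 * z 3 * t * 1) + s * (_ * 0 + 2 * z 4 * r * 1 - 2 * z 4 * s * 0 - 2 * z 3 * s * 1
      - _ * 0 + _ * 0 + 2 * z 3 * t * 0) + -(r * k + s * l) / (1 + z 4 ^ 2) * ((1 + z 4 ^ 2) * 1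
      + _ * 0 - _ * 0 - _ * 0 - _ * 0 + _ * 0 + _ * 0) + 0 * _ + 0 * _ = 0
    field_simp
    simp only [k, l]
    ring
  · simp only [totalY₂, pd_minimalOperator, Fin.reduceEq, if_true, if_false]
    simp only [toJet2]
    change _ + z 4 * _ + s * (_ * 0 + 2 * z 4 * r * 0 - 2 * z 4 * s * 1 - 2 * z 3 * s * 0 - _ * 0
      + _ * 0 + 2 * z 3 * t * 1) + t * (_ * 0 + 2 * z 4 * r * 1 - 2 * z 4 * s * 0 - 2 * z 3 * s * 1
      - _ * 0 + _ * 0 + 2 * z 3 * t * 0) + 0 * _ + 0 * _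
      + -(s * k + t * l) / (1 + z 3 ^ 2) * (_ * 0
      + _ * 0 - _ * 0 - _ * 0 - _ * 0 + (1 + z 3 ^ 2) * 1 + _ * 0) = 0
    field_simp
    simp only [k, l]
    ring
  · ext i
    fin_cases i <;> rfl

open smoothAlgebra in
theorem mem_contactSymmetries_iff (φ : SmoothFun U) :
    φ ∈ contactSymmetries U ↔ (frame U).IsSymmetry φ.toAlgebra := by
  -- Over a fixed first jet, every (r, s, t) in the plane lifts to a third jet on the equation, so
  -- the condition concerns the plane alone. The placeholders are the coefficients in
  -- `evolutionary₂_minimalOperator`.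
  have key : ∀ z : U, (∀ θ ∈ minimalEquation, toJet1 (toJet2 θ) = z →
      evolutionary₂ φ.1 minimalOperator θ = 0) ↔ _ := fun z => Iff.trans
    (b := ∀ r s t : ℝ, (1 + z.1 4 * z.1 4) * r - 2 * z.1 3 * z.1 4 * s
        + (1 + z.1 3 * z.1 3) * t = 0 → _ + 2 * (_ * r + _ * s + _ * t) + (s * s - r * t) * _ = 0)
    ⟨fun h r s t hr => by
      obtain ⟨θ, hθ, hz, rfl, rfl, rfl⟩ := exists_mem_minimalEquation z.1 r s t hr
      have := h θ hθ hz
      rw [evolutionary₂_minimalOperator φ.2.1 (hz ▸ z.2) hz, hθ.1, hθ.2.1, hθ.2.2, mul_zero,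
        mul_zero, mul_zero, add_zero, add_zero, add_zero] at this
      exact this, fun h θ hθ hz => by
      rw [evolutionary₂_minimalOperator φ.2.1 (hz ▸ z.2) hz, hθ.1, hθ.2.1, hθ.2.2, mul_zero,
        mul_zero, mul_zero, add_zero, add_zero, add_zero]
      refine h _ _ _ ?_
      have h1 := hθ.1
      have h3 : θ 3 = z.1 3 := congrFun hz 3
      have h4 : θ 4 = z.1 4 := congrFun hz 4
      change (1 + θ 4 ^ 2) * θ 5 - 2 * θ 3 * θ 4 * θ 6 + (1 + θ 3 ^ 2) * θ 7 = 0 at h1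
      rw [h3, h4] at h1
      linear_combination h1⟩
    (forall_quadratic_eq_zero_iff _ _ _ _ _ _ _
      (((frame U).trace φ.toAlgebra).1 z) (by
        simp only [ContactFrame.trace, SmoothFun.toAlgebra, frame_p, frame_q, P_ofContDiffOn,
          Q_ofContDiffOn, add_apply, mul_apply, one_apply, coord_apply, X_apply, Y_apply]
        ring))
  have hall : φ ∈ contactSymmetries U ↔ ∀ z : U, ∀ θ ∈ minimalEquation, toJet1 (toJet2 θ) = z →
      evolutionary₂ φ.1 minimalOperator θ = 0 :=
    ⟨fun h z θ hθ hz => h θ hθ (hz ▸ z.2), fun h θ hθ hz => h ⟨_, hz⟩ θ hθ rfl⟩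
  rw [hall, ContactFrame.isSymmetry_iff]
  simp only [key, SmoothFun.toAlgebra, ext_iff, ← forall_and, ContactFrame.legendre, frame_p,
    frame_q,
    P_ofContDiffOn, Q_ofContDiffOn, add_apply, sub_apply, neg_apply, mul_apply, zero_apply,
    one_apply, two_apply, coord_apply, ofContDiffOn_apply, X_apply, Y_apply, X_X_apply, X_Y_apply,
    Y_Y_apply]

open smoothAlgebra

theorem toAlgebra_add (φ ψ : SmoothFun U) : (φ + ψ).toAlgebra = φ.toAlgebra + ψ.toAlgebra := rfl

theorem toAlgebra_smul (c : ℝ) (φ : SmoothFun U) : (c • φ).toAlgebra = c • φ.toAlgebra := rfl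

theorem toAlgebra_restrict (f : Jet1 → ℝ) (hf : ContDiffOn ℝ ∞ f U) :
    (restrict U f hf).toAlgebra = ofContDiffOn f hf :=
  smoothAlgebra.ext fun z => Set.indicator_of_mem z.2 f

theorem toAlgebra_lie (φ ψ : SmoothFun U) :
    (⁅φ, ψ⁆ : SmoothFun U).toAlgebra = (frame U).bracket φ.toAlgebra ψ.toAlgebra :=
  smoothAlgebra.ext fun z => by
    refine (bracket_apply φ ψ z.2).trans ?_
    simp only [ContactFrame.bracket, SmoothFun.toAlgebra, Z_ofContDiffOn, P_ofContDiffOn,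
      Q_ofContDiffOn, add_apply, sub_apply, mul_apply, ofContDiffOn_apply, X_apply, Y_apply,
      jacobiBracket]

/-! ### The Lie algebra of normal forms -/

/-- The generators with a normal form. -/
def HasNormalForm (φ : SmoothFun U) : Prop :=
  ∃ a b c d, (frame U).IsNormal φ.toAlgebra a b c d

/-- Connectedness of U makes the four coefficients genuine constants; the fibres play no role yet.
-/
theorem mem_contactSymmetries_iff_hasNormalForm (hU : IsPreconnected (U : Set Jet1))
    (φ : SmoothFun U) : φ ∈ contactSymmetries U ↔ HasNormalForm φ :=
  (mem_contactSymmetries_iff φ).trans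
    ⟨fun h => h.exists_isNormal (exists_eq_algebraMap hU), fun ⟨_, _, _, _, h⟩ => h.isSymmetry⟩

theorem isNormal_zero : (frame U).IsNormal 0 0 0 0 0 :=
  ⟨by simp, by simp, by simp, by simp [ContactFrame.legendre]⟩

variable (U) in
/-- The Lie algebra of the generators with a normal form. -/
def normalForms : LieSubalgebra ℝ (SmoothFun U) where
  carrier := {φ | HasNormalForm φ}
  add_mem' := fun ⟨_, _, _, _, h⟩ ⟨_, _, _, _, h'⟩ => ⟨_, _, _, _, h.add h'⟩
  zero_mem' := ⟨0, 0, 0, 0, isNormal_zero⟩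
  smul_mem' := fun c _ ⟨_, _, _, _, h⟩ => ⟨_, _, _, _, h.smul c⟩
  lie_mem' := fun {φ ψ} ⟨_, _, _, _, h⟩ ⟨_, _, _, _, h'⟩ =>
    ⟨_, _, _, _, toAlgebra_lie φ ψ ▸ h.bracket h'⟩

section Generators

theorem toAlgebra_rotationXY :
    (rotationXY U).toAlgebra = coord U 1 * coord U 3 - coord U 0 * coord U 4 :=
  toAlgebra_restrict _ _

theorem toAlgebra_rotationX : (rotationX U).toAlgebra = coord U 0 + coord U 2 * coord U 3 :=
  toAlgebra_restrict _ _

theorem toAlgebra_rotationY : (rotationY U).toAlgebra = coord U 1 + coord U 2 * coord U 4 :=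
  toAlgebra_restrict _ _

theorem toAlgebra_dilatation :
    (dilatation U).toAlgebra = coord U 2 - coord U 0 * coord U 3 - coord U 1 * coord U 4 :=
  toAlgebra_restrict _ _

theorem isNormal_rotationXY : (frame U).IsNormal (rotationXY U).toAlgebra 1 0 0 0 := by
  rw [toAlgebra_rotationXY]
  refine ⟨?_, ?_, ?_, ?_⟩
  · simp [frame_X, frame_p, frame_q, partialDeriv_coord]
    ring
  all_goals simp [ContactFrame.legendre, frame_Y, frame_Z, frame_P, frame_Q, frame_p,
    frame_q, partialDeriv_coord]

theorem isNormal_rotationX : (frame U).IsNormal (rotationX U).toAlgebra 0 1 0 0 := by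
  rw [toAlgebra_rotationX]
  constructor <;> simp [ContactFrame.legendre, frame_X, frame_Y, frame_Z, frame_P, frame_Q, frame_p,
    frame_q, partialDeriv_coord, mul_comm]

theorem isNormal_rotationY : (frame U).IsNormal (rotationY U).toAlgebra 0 0 1 0 := by
  rw [toAlgebra_rotationY]
  constructor <;> simp [ContactFrame.legendre, frame_X, frame_Y, frame_Z, frame_P, frame_Q, frame_p,
    frame_q, partialDeriv_coord, mul_comm]

theorem isNormal_dilatation : (frame U).IsNormal (dilatation U).toAlgebra 0 0 0 1 := by
  rw [toAlgebra_dilatation]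
  constructor <;> simp [ContactFrame.legendre, frame_X, frame_Y, frame_Z, frame_P, frame_Q, frame_p,
    frame_q, partialDeriv_coord]

end Generators

/-! ### Functions of the slopes -/

section Slopes

/-- The projection to the slopes `(u_x, u_y)`. -/
def slopeMap : Jet1 →L[ℝ] (Fin 2 → ℝ) :=
  ContinuousLinearMap.pi ![ContinuousLinearMap.proj 3, ContinuousLinearMap.proj 4]

theorem slopeMap_apply (z : Jet1) : slopeMap z = ![z 3, z 4] := by
  ext i
  fin_cases i <;> rfl

/-- The section of the projection to the slopes that vanishes on the other coordinates. -/
def slopeSection : (Fin 2 → ℝ) →L[ℝ] Jet1 :=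
  ContinuousLinearMap.pi ![0, 0, 0, ContinuousLinearMap.proj 0, ContinuousLinearMap.proj 1]

theorem slopeMap_slopeSection (w : Fin 2 → ℝ) : slopeMap (slopeSection w) = w := by
  ext i
  fin_cases i <;> rfl

theorem slopes_eq : slopes U = slopeMap '' U := by
  simp only [slopes, ← slopeMap_apply]

theorem isOpen_slopes : IsOpen (slopes U) := by
  rw [slopes_eq]
  exact slopeMap.isOpenMap (fun w => ⟨slopeSection w, slopeMap_slopeSection w⟩) _ U.isOpen

theorem slopeMap_mem {z : Jet1} (hz : z ∈ U) : slopeMap z ∈ slopes U :=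
  slopes_eq ▸ Set.mem_image_of_mem _ hz

theorem slopeMap_single_three : slopeMap (Pi.single 3 1) = Pi.single 0 1 := by
  ext i
  fin_cases i <;> simp [slopeMap_apply]

theorem slopeMap_single_four : slopeMap (Pi.single 4 1) = Pi.single 1 1 := by
  ext i
  fin_cases i <;> simp [slopeMap_apply]

theorem slopeMap_single_of_lt {i : Fin 5} (hi : i < 3) : slopeMap (Pi.single i 1) = 0 := by
  ext k
  fin_cases i <;> fin_cases k <;> first | exact absurd hi (by decide) | simp [slopeMap_apply]

variable {f : Jet1 → ℝ} {ϕ : (Fin 2 → ℝ) → ℝ}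

theorem pd_of_eqOn_comp_slopeMap (hϕ : ContDiffOn ℝ ∞ ϕ (slopes U))
    (h : Set.EqOn f (fun z => ϕ (slopeMap z)) U) (i : Fin 5) {z : Jet1} (hz : z ∈ U) :
    pd i f z = fderiv ℝ ϕ (slopeMap z) (slopeMap (Pi.single i 1)) := by
  have hd : DifferentiableAt ℝ ϕ (slopeMap z) :=
    (hϕ.contDiffAt (isOpen_slopes.mem_nhds (slopeMap_mem hz))).differentiableAt (by simp)
  have hc := (hd.hasFDerivAt.comp z slopeMap.hasFDerivAt).fderiv
  rw [pd_congr i h hz]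
  exact congrArg (fun L : Jet1 →L[ℝ] ℝ => L (Pi.single i 1)) hc

theorem contDiffOn_pd (hϕ : ContDiffOn ℝ ∞ ϕ (slopes U)) (i : Fin 2) :
    ContDiffOn ℝ ∞ (pd i ϕ) (slopes U) :=
  (hϕ.fderiv_of_isOpen isOpen_slopes (by simp)).clm_apply contDiffOn_const

theorem pd_three_of_eqOn (hϕ : ContDiffOn ℝ ∞ ϕ (slopes U))
    (h : Set.EqOn f (fun z => ϕ (slopeMap z)) U) :
    Set.EqOn (pd 3 f) (fun z => pd 0 ϕ (slopeMap z)) U := fun _ hz => by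
  rw [pd_of_eqOn_comp_slopeMap hϕ h 3 hz, slopeMap_single_three]
  rfl

theorem pd_four_of_eqOn (hϕ : ContDiffOn ℝ ∞ ϕ (slopes U))
    (h : Set.EqOn f (fun z => ϕ (slopeMap z)) U) :
    Set.EqOn (pd 4 f) (fun z => pd 1 ϕ (slopeMap z)) U := fun _ hz => by
  rw [pd_of_eqOn_comp_slopeMap hϕ h 4 hz, slopeMap_single_four]
  rfl

theorem pd_eq_zero_of_eqOn (hϕ : ContDiffOn ℝ ∞ ϕ (slopes U))
    (h : Set.EqOn f (fun z => ϕ (slopeMap z)) U) {i : Fin 5} (hi : i < 3) {z : Jet1} (hz : z ∈ U) :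
    pd i f z = 0 := by
  rw [pd_of_eqOn_comp_slopeMap hϕ h i hz, slopeMap_single_of_lt hi, map_zero]

/-- For a function of the slopes, the Legendre operator on `U` is the one on the slopes. -/
theorem legendre_apply_of_eqOn (hϕ : ContDiffOn ℝ ∞ ϕ (slopes U)) (φ : SmoothFun U)
    (h : Set.EqOn φ.1 (fun z => ϕ (slopeMap z)) U) (z : U) :
    ((frame U).legendre φ.toAlgebra).1 z =
      (1 + slopeMap z.1 0 ^ 2) * pd 0 (pd 0 ϕ) (slopeMap z)
        + 2 * slopeMap z.1 0 * slopeMap z.1 1 * pd 1 (pd 0 ϕ) (slopeMap z)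
        + (1 + slopeMap z.1 1 ^ 2) * pd 1 (pd 1 ϕ) (slopeMap z) := by
  have h3 := pd_three_of_eqOn hϕ h
  have h4 := pd_four_of_eqOn hϕ h
  simp only [ContactFrame.legendre, SmoothFun.toAlgebra, frame_p, frame_q, P_ofContDiffOn,
    Q_ofContDiffOn, add_apply, mul_apply, one_apply, two_apply, coord_apply, ofContDiffOn_apply]
  rw [pd_comm 3 4 φ.2.1 z.2, pd_three_of_eqOn (contDiffOn_pd hϕ 0) h3 z.2,
    pd_four_of_eqOn (contDiffOn_pd hϕ 0) h3 z.2, pd_four_of_eqOn (contDiffOn_pd hϕ 1) h4 z.2]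
  simp only [slopeMap_apply, Matrix.cons_val_zero, Matrix.cons_val_one]
  ring

theorem isNormal_of_mem_legendreSolutions {φ : SmoothFun U} (hφ : φ ∈ legendreSolutions U) :
    (frame U).IsNormal φ.toAlgebra 0 0 0 0 := by
  obtain ⟨ϕ, hϕ, hsol, heq⟩ := hφ
  have h : Set.EqOn φ.1 (fun z => ϕ (slopeMap z)) U := fun z hz => by
    simpa only [slopeMap_apply] using heq z hz
  constructor
  · refine smoothAlgebra.ext fun z => (X_apply φ.2.1 z).trans ?_
    simp [pd_eq_zero_of_eqOn hϕ h (i := 0) (by decide) z.2,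
      pd_eq_zero_of_eqOn hϕ h (i := 2) (by decide) z.2]
  · refine smoothAlgebra.ext fun z => (Y_apply φ.2.1 z).trans ?_
    simp [pd_eq_zero_of_eqOn hϕ h (i := 1) (by decide) z.2,
      pd_eq_zero_of_eqOn hϕ h (i := 2) (by decide) z.2]
  · refine smoothAlgebra.ext fun z => (ext_iff.1 (Z_ofContDiffOn φ.2.1) z).trans ?_
    simp [pd_eq_zero_of_eqOn hϕ h (i := 2) (by decide) z.2]
  · exact smoothAlgebra.ext fun z =>
      (legendre_apply_of_eqOn hϕ φ h z).trans (hsol _ (slopeMap_mem z.2))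

end Slopes

/-! ### Descent along the connected fibres -/

section Fibres

/-- The inclusion of the coordinates `(x, y, u)`. -/
def pointInclusion : (Fin 3 → ℝ) →L[ℝ] Jet1 :=
  ContinuousLinearMap.pi ![ContinuousLinearMap.proj 0, ContinuousLinearMap.proj 1,
    ContinuousLinearMap.proj 2, 0, 0]

theorem pointInclusion_single (i : Fin 3) (h : 3 ≤ 5) :
    pointInclusion (Pi.single i 1) = Pi.single (Fin.castLE h i) 1 := by
  ext k
  fin_cases i <;> fin_cases k <;> simp [pointInclusion]

/-- A fibre is a connected open subset of an affine copy of ℝ³, along which the derivative of f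
vanishes. -/
theorem eq_of_slopeMap_eq {f : Jet1 → ℝ} (hf : ContDiffOn ℝ ∞ f U)
    (hfiber : ∀ p q : ℝ, IsPreconnected {z : Jet1 | z ∈ U ∧ z 3 = p ∧ z 4 = q})
    (h0 : ∀ i : Fin 5, i < 3 → ∀ z ∈ U, pd i f z = 0) {z z' : Jet1} (hz : z ∈ U) (hz' : z' ∈ U)
    (h : slopeMap z = slopeMap z') : f z = f z' := by
  set b : Jet1 := slopeSection (slopeMap z) with hb
  let π : Jet1 → Fin 3 → ℝ := fun y => ![y 0, y 1, y 2]
  let j : (Fin 3 → ℝ) → Jet1 := fun v => pointInclusion v + b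
  have hj : Continuous j := by fun_prop
  have hjπ : ∀ y : Jet1, slopeMap y = slopeMap z → j (π y) = y := by
    intro y hy
    have h3 : y 3 = z 3 := by simpa [slopeMap_apply] using congrFun hy 0
    have h4 : y 4 = z 4 := by simpa [slopeMap_apply] using congrFun hy 1
    ext k
    fin_cases k <;> simp [j, π, b, pointInclusion, slopeSection, slopeMap_apply, h3, h4]
  -- The fibre in coordinates (x, y, u) is the image of the given fibre under a continuous
  -- projection, and so inherits preconnectedness.
  have hV : j ⁻¹' U = π '' {y : Jet1 | y ∈ U ∧ y 3 = z 3 ∧ y 4 = z 4} := by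
    ext v
    constructor
    · intro hv
      refine ⟨j v, ⟨hv, ?_, ?_⟩, ?_⟩
      · simp [j, b, pointInclusion, slopeSection, slopeMap_apply]
      · simp [j, b, pointInclusion, slopeSection, slopeMap_apply]
      · ext k
        fin_cases k <;> simp [j, π, b, pointInclusion, slopeSection]
    · rintro ⟨y, ⟨hy, h3, h4⟩, rfl⟩
      have : j (π y) = y := hjπ y (by rw [slopeMap_apply, slopeMap_apply, h3, h4])
      rwa [Set.mem_preimage, this]
  have hVpre : IsPreconnected (j ⁻¹' U) := by
    rw [hV]
    exact (hfiber _ _).image _ (by fun_prop)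
  have hd : ∀ v ∈ j ⁻¹' (U : Set Jet1),
      HasFDerivAt (fun v => f (j v)) ((fderiv ℝ f (j v)).comp pointInclusion) v := fun v hv =>
    (differentiableAt_of_smooth hf hv).hasFDerivAt.comp v
      (pointInclusion.hasFDerivAt.add_const b)
  obtain ⟨r, hr⟩ := (U.isOpen.preimage hj).exists_is_const_of_fderiv_eq_zero (𝕜 := ℝ) hVpre
    (f := fun v => f (j v)) (fun v hv => (hd v hv).differentiableAt.differentiableWithinAt)
    (fun v hv => by
      rw [(hd v hv).fderiv]
      refine ContinuousLinearMap.coe_injective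
        (LinearMap.pi_ext' fun i => LinearMap.ext_ring ?_)
      have := h0 (Fin.castLE (by decide) i) (by fin_cases i <;> decide) (j v) hv
      simpa [pointInclusion_single i (by decide), pd] using this)
  have e := hjπ z rfl
  have e' := hjπ z' h.symm
  have k := hr (π z) (by rwa [Set.mem_preimage, e])
  have k' := hr (π z') (by rwa [Set.mem_preimage, e'])
  rw [e] at k
  rw [e'] at k'
  exact k.trans k'.symm

open Classical in
theorem mem_legendreSolutions_of_isNormal
    (hfiber : ∀ p q : ℝ, IsPreconnected {z : Jet1 | z ∈ U ∧ z 3 = p ∧ z 4 = q})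
    {φ : SmoothFun U} (h : (frame U).IsNormal φ.toAlgebra 0 0 0 0) : φ ∈ legendreSolutions U := by
  have h2 : ∀ z ∈ U, pd 2 φ.1 z = 0 := fun z hz => by
    have := ext_iff.1 ((Z_ofContDiffOn φ.2.1).symm.trans h.Z_eq) ⟨z, hz⟩
    simpa using this
  have h01 : ∀ i : Fin 5, i < 3 → ∀ z ∈ U, pd i φ.1 z = 0 := by
    intro i hi z hz
    have hX := (X_apply φ.2.1 ⟨z, hz⟩).symm.trans (ext_iff.1 h.X_eq ⟨z, hz⟩)
    have hY := (Y_apply φ.2.1 ⟨z, hz⟩).symm.trans (ext_iff.1 h.Y_eq ⟨z, hz⟩)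
    simp [h2 z hz] at hX hY
    fin_cases i
    · exact hX
    · exact hY
    · exact h2 z hz
    · exact absurd hi (by decide)
    · exact absurd hi (by decide)
  -- The value is taken at an arbitrary point of the fibre; `eq_of_slopeMap_eq` makes the choice
  -- immaterial.
  let ϕ : (Fin 2 → ℝ) → ℝ := fun w => if hw : ∃ z ∈ U, slopeMap z = w then φ.1 hw.choose else 0
  have hval : Set.EqOn φ.1 (fun z => ϕ (slopeMap z)) U := fun z hz => by
    have hw : ∃ y ∈ U, slopeMap y = slopeMap z := ⟨z, hz, rfl⟩
    simp only [ϕ, dif_pos hw]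
    exact eq_of_slopeMap_eq φ.2.1 hfiber h01 hz hw.choose_spec.1 hw.choose_spec.2.symm
  have hsmooth : ContDiffOn ℝ ∞ ϕ (slopes U) := by
    rw [slopes_eq]
    rintro _ ⟨z, hz, rfl⟩
    -- An affine section of the slope projection through z: near the slope of z, ϕ equals φ ∘ k,
    -- hence is smooth, although the choice of points need not be continuous.
    let k : (Fin 2 → ℝ) → Jet1 := fun w => z + slopeSection (w - slopeMap z)
    have hk : ContDiff ℝ ∞ k := by fun_prop
    have hkz : k (slopeMap z) = z := by simp [k]
    have hmem : k ⁻¹' U ∈ nhds (slopeMap z) :=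
      hk.continuous.continuousAt.preimage_mem_nhds (by rw [hkz]; exact U.isOpen.mem_nhds hz)
    have hφz : ContDiffAt ℝ ∞ φ.1 (k (slopeMap z)) := by
      rw [hkz]
      exact φ.2.1.contDiffAt (U.isOpen.mem_nhds hz)
    refine ContDiffAt.contDiffWithinAt ((hφz.comp _ hk.contDiffAt).congr_of_eventuallyEq ?_)
    filter_upwards [hmem] with w hw
    have := hval hw
    simp only [k, map_add, slopeMap_slopeSection, add_sub_cancel] at this
    exact this.symm
  refine ⟨ϕ, hsmooth, ?_, fun z hz => by simpa only [slopeMap_apply] using hval hz⟩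
  intro w hw
  rw [slopes_eq] at hw
  obtain ⟨z, hz, rfl⟩ := hw
  exact (legendre_apply_of_eqOn hsmooth φ hval ⟨z, hz⟩).symm.trans (ext_iff.1 h.legendre_eq _)

end Fibres

/-! ### Generators and spans -/

theorem restrict_mem_legendreSolutions (ϕ : (Fin 2 → ℝ) → ℝ) (hϕ : ContDiff ℝ ∞ ϕ)
    (f : Jet1 → ℝ) (hf : ContDiffOn ℝ ∞ f U) (hsol : SolvesLegendre ϕ (slopes U))
    (h : ∀ z, f z = ϕ ![z 3, z 4]) : restrict U f hf ∈ legendreSolutions U :=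
  ⟨ϕ, hϕ.contDiffOn, hsol, fun z hz => (Set.indicator_of_mem hz f).trans (h z)⟩

theorem pd_const {n : ℕ} (i : Fin n) (c : ℝ) : pd i (fun _ => c) = fun _ => 0 := by
  funext z
  simp [pd]

theorem pd_coord_eq_const {n : ℕ} (i j : Fin n) :
    pd i (fun w : Fin n → ℝ => w j) = fun _ => if j = i then 1 else 0 :=
  funext fun _ => pd_fun_coord i j

theorem shift_mem_legendreSolutions : shift U ∈ legendreSolutions U :=
  restrict_mem_legendreSolutions (fun _ => 1) contDiff_const _ _
    (fun w _ => by simp [pd_const]) fun _ => rfl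

theorem translationX_mem_legendreSolutions : translationX U ∈ legendreSolutions U :=
  restrict_mem_legendreSolutions (fun w => w 0) (by fun_prop) _ _
    (fun w _ => by simp [pd_const, pd_coord_eq_const]) fun _ => rfl

theorem translationY_mem_legendreSolutions : translationY U ∈ legendreSolutions U :=
  restrict_mem_legendreSolutions (fun w => w 1) (by fun_prop) _ _
    (fun w _ => by simp [pd_const, pd_coord_eq_const]) fun _ => rfl

theorem translations_subset_legendreSolutions :
    {shift U, translationX U, translationY U} ⊆ legendreSolutions U := by
  rintro φ (rfl | rfl | rfl)
  exacts [shift_mem_legendreSolutions, translationX_mem_legendreSolutions,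
    translationY_mem_legendreSolutions]

theorem pointGenerators_subset_normalForms : pointGenerators U ⊆ normalForms U := by
  rintro φ (rfl | rfl | rfl | rfl | rfl | rfl | rfl)
  exacts [⟨_, _, _, _, isNormal_of_mem_legendreSolutions shift_mem_legendreSolutions⟩,
    ⟨_, _, _, _, isNormal_of_mem_legendreSolutions translationX_mem_legendreSolutions⟩,
    ⟨_, _, _, _, isNormal_of_mem_legendreSolutions translationY_mem_legendreSolutions⟩,
    ⟨_, _, _, _, isNormal_rotationXY⟩, ⟨_, _, _, _, isNormal_rotationX⟩,
    ⟨_, _, _, _, isNormal_rotationY⟩, ⟨_, _, _, _, isNormal_dilatation⟩]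

theorem generators_subset_normalForms :
    legendreSolutions U ∪ pointGenerators U ⊆ normalForms U :=
  Set.union_subset (fun _ h => ⟨_, _, _, _, isNormal_of_mem_legendreSolutions h⟩)
    pointGenerators_subset_normalForms

theorem smul_mem_span_pointGenerators (r : ℝ) {χ : SmoothFun U} (hχ : χ ∈ pointGenerators U) :
    r • χ ∈ Submodule.span ℝ (pointGenerators U) :=
  Submodule.smul_mem _ r (Submodule.subset_span hχ)

theorem rotations_dilatation_mem_span (a b c d : ℝ) :
    a • rotationXY U + b • rotationX U + c • rotationY U + d • dilatation U ∈
      Submodule.span ℝ (pointGenerators U) := by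
  refine Submodule.add_mem _ (Submodule.add_mem _ (Submodule.add_mem _ ?_ ?_) ?_) ?_ <;>
    exact smul_mem_span_pointGenerators _ (by simp [pointGenerators])

theorem isNormal_rotations_dilatation (a b c d : ℝ) :
    (frame U).IsNormal (a • rotationXY U + b • rotationX U + c • rotationY U
      + d • dilatation U).toAlgebra a b c d := by
  simp only [toAlgebra_add, toAlgebra_smul]
  have h := (((isNormal_rotationXY (U := U)).smul a).add (isNormal_rotationX.smul b)).add
    (isNormal_rotationY.smul c) |>.add (isNormal_dilatation.smul d)
  exact h.congr (by ring) (by ring) (by ring) (by ring)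

/-- A generator with a normal form differs from a function of the slopes by a combination of the
rotations and the dilatation. -/
theorem HasNormalForm.exists_add_mem_legendreSolutions
    (hfiber : ∀ p q : ℝ, IsPreconnected {z : Jet1 | z ∈ U ∧ z 3 = p ∧ z 4 = q})
    {φ : SmoothFun U} (h : HasNormalForm φ) :
    ∃ χ ∈ Submodule.span ℝ (pointGenerators U), φ + χ ∈ legendreSolutions U := by
  obtain ⟨a, b, c, d, h⟩ := h
  refine ⟨_, rotations_dilatation_mem_span (-a) (-b) (-c) (-d),
    mem_legendreSolutions_of_isNormal hfiber ?_⟩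
  rw [toAlgebra_add]
  exact (h.add (isNormal_rotations_dilatation (-a) (-b) (-c) (-d))).congr
    (add_neg_cancel a) (add_neg_cancel b) (add_neg_cancel c) (add_neg_cancel d)

theorem HasNormalForm.mem_span
    (hfiber : ∀ p q : ℝ, IsPreconnected {z : Jet1 | z ∈ U ∧ z 3 = p ∧ z 4 = q})
    {φ : SmoothFun U} (h : HasNormalForm φ) :
    φ ∈ Submodule.span ℝ (legendreSolutions U ∪ pointGenerators U) := by
  obtain ⟨χ, hχ, hψ⟩ := h.exists_add_mem_legendreSolutions hfiber
  have hχ' := Submodule.span_mono (Set.subset_union_right (s := legendreSolutions U)) hχ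
  have hψ' := Submodule.subset_span (R := ℝ)
    (Set.subset_union_left (t := pointGenerators U) hψ)
  exact (Submodule.add_mem_iff_left _ hχ').1 hψ'

/-! ### Point symmetries -/

section PointSymmetries

variable (U) in
/-- The functions of the form `η - ξ u_x - ζ u_y` with `ξ, ζ, η` functions of `(x, y, u)`. -/
def pointForms : Submodule ℝ (SmoothFun U) where
  carrier := {φ | ∃ ξ ζ η : ℝ → ℝ → ℝ → ℝ, ∀ z ∈ U,
    φ.1 z = η (z 0) (z 1) (z 2) - ξ (z 0) (z 1) (z 2) * z 3 - ζ (z 0) (z 1) (z 2) * z 4}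
  add_mem' := by
    rintro φ ψ ⟨ξ, ζ, η, h⟩ ⟨ξ', ζ', η', h'⟩
    refine ⟨fun x y u => ξ x y u + ξ' x y u, fun x y u => ζ x y u + ζ' x y u,
      fun x y u => η x y u + η' x y u, fun z hz => ?_⟩
    rw [coe_add_apply, h z hz, h' z hz]
    ring
  zero_mem' := ⟨fun _ _ _ => 0, fun _ _ _ => 0, fun _ _ _ => 0, fun z _ => by simp⟩
  smul_mem' := by
    rintro c φ ⟨ξ, ζ, η, h⟩
    refine ⟨fun x y u => c * ξ x y u, fun x y u => c * ζ x y u, fun x y u => c * η x y u,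
      fun z hz => ?_⟩
    change c * φ.1 z = _
    rw [h z hz]
    ring

theorem restrict_mem_pointForms (ξ ζ η : ℝ → ℝ → ℝ → ℝ) (f : Jet1 → ℝ)
    (hf : ContDiffOn ℝ ∞ f U) (h : ∀ z, f z = η (z 0) (z 1) (z 2) - ξ (z 0) (z 1) (z 2) * z 3
      - ζ (z 0) (z 1) (z 2) * z 4) : restrict U f hf ∈ pointForms U :=
  ⟨ξ, ζ, η, fun z hz => (Set.indicator_of_mem hz f).trans (h z)⟩

theorem pointGenerators_subset_pointForms : pointGenerators U ⊆ pointForms U := by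
  rintro φ (rfl | rfl | rfl | rfl | rfl | rfl | rfl)
  · exact restrict_mem_pointForms (fun _ _ _ => 0) (fun _ _ _ => 0) (fun _ _ _ => 1) _ _
      fun z => by ring
  · exact restrict_mem_pointForms (fun _ _ _ => -1) (fun _ _ _ => 0) (fun _ _ _ => 0) _ _
      fun z => by ring
  · exact restrict_mem_pointForms (fun _ _ _ => 0) (fun _ _ _ => -1) (fun _ _ _ => 0) _ _
      fun z => by ring
  · exact restrict_mem_pointForms (fun _ y _ => -y) (fun x _ _ => x) (fun _ _ _ => 0) _ _
      fun z => by ring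
  · exact restrict_mem_pointForms (fun _ _ u => -u) (fun _ _ _ => 0) (fun x _ _ => x) _ _
      fun z => by ring
  · exact restrict_mem_pointForms (fun _ _ _ => 0) (fun _ _ u => -u) (fun _ y _ => y) _ _
      fun z => by ring
  · exact restrict_mem_pointForms (fun x _ _ => x) (fun _ y _ => y) (fun _ _ u => u) _ _
      fun z => by ring

/-- A partial derivative is determined by the values along a coordinate line. -/
theorem pd_eq_of_affine {f : Jet1 → ℝ} {z : Jet1} (hf : DifferentiableAt ℝ f z) (hz : z ∈ U)
    (i : Fin 5) (a b : ℝ)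
    (h : ∀ t : ℝ, z + t • Pi.single i 1 ∈ U → f (z + t • Pi.single i 1) = a + b * t) :
    pd i f z = b := by
  have h1 : HasDerivAt (fun t : ℝ => f (z + t • Pi.single i 1)) (pd i f z) 0 :=
    hf.hasFDerivAt.hasLineDerivAt (Pi.single i 1)
  have h2 : HasDerivAt (fun t : ℝ => a + b * t) b 0 := by
    simpa using ((hasDerivAt_id (0 : ℝ)).const_mul b).const_add a
  have hc : Continuous fun t : ℝ => z + t • (Pi.single i 1 : Jet1) := by fun_prop
  have hmem : ∀ᶠ t : ℝ in nhds 0, z + t • (Pi.single i 1 : Jet1) ∈ U :=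
    hc.continuousAt.preimage_mem_nhds (by simpa using U.isOpen.mem_nhds hz)
  exact h1.unique (h2.congr_of_eventuallyEq (hmem.mono h))

/-- The derivative φ_p = -ξ depends only on (x, y, u), but it is also killed by X, Y, Z because φ
is. So all its partial derivatives vanish and it is constant on the connected set U; the same holds
for φ_q, and φ is affine in the slopes. -/
theorem mem_span_of_legendreSolutions_of_pointForms (hU : IsPreconnected (U : Set Jet1))
    {φ : SmoothFun U} (hφ : φ ∈ legendreSolutions U) (hpoint : φ ∈ pointForms U) :
    φ ∈ Submodule.span ℝ (pointGenerators U) := by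
  obtain ⟨ξ, ζ, η, h⟩ := hpoint
  have hN := isNormal_of_mem_legendreSolutions hφ
  have hX : (frame U).X φ.toAlgebra = 0 := hN.X_eq_zero
  have hY : (frame U).Y φ.toAlgebra = 0 := hN.Y_eq_zero
  have hZ : (frame U).Z φ.toAlgebra = 0 := hN.Z_eq_zero
  have h3 : ∀ z ∈ U, pd 3 φ.1 z = -ξ (z 0) (z 1) (z 2) := fun z hz =>
    pd_eq_of_affine (differentiableAt_of_smooth φ.2.1 hz) hz 3 (φ.1 z) _ fun t ht => by
      rw [h _ ht, h z hz]
      simp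
      ring
  have h4 : ∀ z ∈ U, pd 4 φ.1 z = -ζ (z 0) (z 1) (z 2) := fun z hz =>
    pd_eq_of_affine (differentiableAt_of_smooth φ.2.1 hz) hz 4 (φ.1 z) _ fun t ht => by
      rw [h _ ht, h z hz]
      simp
      ring
  -- No regularity of κ is available, so the derivative of f is computed along a coordinate line, on
  -- which κ is constant.
  have hconst : ∀ (f : Jet1 → ℝ) (hf : ContDiffOn ℝ ∞ f U) (i : Fin 5) (κ : ℝ → ℝ → ℝ → ℝ),
      3 ≤ i → (∀ z ∈ U, f z = κ (z 0) (z 1) (z 2)) → ∀ z ∈ U, pd i f z = 0 := by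
    intro f hf i κ hi hκ z hz
    refine pd_eq_of_affine (differentiableAt_of_smooth hf hz) hz i (f z) 0 fun t ht => ?_
    rw [hκ _ ht, hκ z hz]
    have e : ∀ k : Fin 5, k < 3 → (z + t • (Pi.single i 1 : Jet1)) k = z k := fun k hk => by
      have : k ≠ i := (hk.trans_le hi).ne
      simp [this]
    rw [e 0 (by decide), e 1 (by decide), e 2 (by decide)]
    ring
  obtain ⟨b, hb⟩ := exists_eq_algebraMap hU ((frame U).P φ.toAlgebra)
    hN.X_P_eq_zero hN.Y_P_eq_zero hN.Z_P_eq_zero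
    (by
      rw [SmoothFun.toAlgebra, P_ofContDiffOn, P_ofContDiffOn]
      exact smoothAlgebra.ext fun z =>
        hconst _ (pd_smooth 3 φ.2.1) 3 (fun x y u => -ξ x y u) (by decide) h3 z z.2)
    (by
      rw [SmoothFun.toAlgebra, P_ofContDiffOn, Q_ofContDiffOn]
      exact smoothAlgebra.ext fun z =>
        hconst _ (pd_smooth 3 φ.2.1) 4 (fun x y u => -ξ x y u) (by decide) h3 z z.2)
  obtain ⟨c, hc⟩ := exists_eq_algebraMap hU ((frame U).Q φ.toAlgebra)
    hN.X_Q_eq_zero hN.Y_Q_eq_zero hN.Z_Q_eq_zero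
    (by
      rw [SmoothFun.toAlgebra, Q_ofContDiffOn, P_ofContDiffOn]
      exact smoothAlgebra.ext fun z =>
        hconst _ (pd_smooth 4 φ.2.1) 3 (fun x y u => -ζ x y u) (by decide) h4 z z.2)
    (by
      rw [SmoothFun.toAlgebra, Q_ofContDiffOn, Q_ofContDiffOn]
      exact smoothAlgebra.ext fun z =>
        hconst _ (pd_smooth 4 φ.2.1) 4 (fun x y u => -ζ x y u) (by decide) h4 z z.2)
  obtain ⟨a, ha⟩ := exists_eq_algebraMap hU
    (φ.toAlgebra - algebraMap ℝ _ b * (frame U).p - algebraMap ℝ _ c * (frame U).q)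
    (by simp [hX]) (by simp [hY]) (by simp [hZ]) (by simp [hb]) (by simp [hc])
  have hφ' : φ = a • shift U + b • translationX U + c • translationY U := ext_on fun z hz => by
    have e : φ.1 z - b * z 3 - c * z 4 = a := ext_iff.1 ha ⟨z, hz⟩
    have s : ∀ (f : Jet1 → ℝ) (hf : ContDiffOn ℝ ∞ f U), (restrict U f hf).1 z = f z :=
      fun f _ => Set.indicator_of_mem hz f
    change _ = a * (shift U).1 z + b * (translationX U).1 z + c * (translationY U).1 z
    rw [shift, translationX, translationY, s, s, s]
    linear_combination e
  rw [hφ']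
  refine add_mem (add_mem ?_ ?_) ?_ <;>
    exact Submodule.smul_mem _ _ (Submodule.subset_span (by simp [pointGenerators]))

end PointSymmetries

end MinimalSurface

theorem proposition1 (U : TopologicalSpace.Opens MinimalSurface.Jet1)
    (hU : IsPreconnected (U : Set MinimalSurface.Jet1))
    (hfiber : ∀ p q : ℝ,
      IsPreconnected {z : MinimalSurface.Jet1 | z ∈ U ∧ z 3 = p ∧ z 4 = q}) :
    MinimalSurface.contactSymmetries U =
        (LieSubalgebra.lieSpan ℝ (MinimalSurface.SmoothFun U)
          (MinimalSurface.legendreSolutions U ∪ MinimalSurface.pointGenerators U) :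
          Set (MinimalSurface.SmoothFun U)) ∧
      MinimalSurface.contactSymmetries U =
        (Submodule.span ℝ
          (MinimalSurface.legendreSolutions U ∪ MinimalSurface.pointGenerators U) :
          Set (MinimalSurface.SmoothFun U)) ∧
      {MinimalSurface.shift U, MinimalSurface.translationX U, MinimalSurface.translationY U} ⊆
        MinimalSurface.legendreSolutions U ∧
      MinimalSurface.pointSymmetries U =
        (Submodule.span ℝ (MinimalSurface.pointGenerators U) :
          Set (MinimalSurface.SmoothFun U)) := by
  have hcontact : ∀ φ, φ ∈ MinimalSurface.contactSymmetries U ↔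
      φ ∈ MinimalSurface.normalForms U :=
    MinimalSurface.mem_contactSymmetries_iff_hasNormalForm hU
  have hspan : ∀ φ ∈ MinimalSurface.normalForms U, φ ∈ Submodule.span ℝ
      (MinimalSurface.legendreSolutions U ∪ MinimalSurface.pointGenerators U) := fun φ hφ =>
    MinimalSurface.HasNormalForm.mem_span hfiber hφ
  refine ⟨?_, ?_, MinimalSurface.translations_subset_legendreSolutions, ?_⟩
  · ext φ
    rw [hcontact]
    -- The symmetries lie in the linear span, which lies in the Lie span, which lies in the Lie
    -- subalgebra `normalForms U`, the set of symmetries itself; so all of these coincide.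
    exact ⟨fun hφ => LieSubalgebra.submodule_span_le_lieSpan (hspan φ hφ),
      fun hφ => LieSubalgebra.lieSpan_le.2 MinimalSurface.generators_subset_normalForms hφ⟩
  · ext φ
    rw [hcontact]
    exact ⟨hspan φ, fun hφ => Submodule.span_le (p := (MinimalSurface.normalForms U).toSubmodule).2
      MinimalSurface.generators_subset_normalForms hφ⟩
  · ext φ
    constructor
    · rintro ⟨hφ, hpoint⟩
      obtain ⟨χ, hχ, hψ⟩ := MinimalSurface.HasNormalForm.exists_add_mem_legendreSolutions hfiber
        ((hcontact φ).1 hφ)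
      -- The correction χ is itself of point form, so φ + χ is both of point form and a function of
      -- the slopes.
      have hχ' := Submodule.span_le.2 MinimalSurface.pointGenerators_subset_pointForms hχ
      have hmem := MinimalSurface.mem_span_of_legendreSolutions_of_pointForms hU hψ
        (add_mem (show φ ∈ MinimalSurface.pointForms U from hpoint) hχ')
      exact (Submodule.add_mem_iff_left _ hχ).1 hmem
    · intro hφ
      exact ⟨(hcontact φ).2 (Submodule.span_le
          (p := (MinimalSurface.normalForms U).toSubmodule).2
          MinimalSurface.pointGenerators_subset_normalForms hφ),
        Submodule.span_le.2 MinimalSurface.pointGenerators_subset_pointForms hφ⟩
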